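/- Let $d\in\mathbb N$ and $0\le t<T$. Write $\mathcal P_2(\mathbb R^d)$ for the Borel probability measures on $\mathbb R^d$ with finite second moment and $\mathcal W_2$ for the quadratic Wasserstein distance. Let $b:\mathbb R^d\times\mathcal P_2(\mathbb R^d)\to\mathbb R^d$ be such that, for some $R>0$ and all $m\in\mathcal P_2(\mathbb R^d)$, $x\in\mathbb R^d$, we have $b(\cdot,m)\in C^2_c(B(0,R))$ and $\frac{\delta b}{\delta m}(x,m,\cdot)\in C^2_c(B(0,R))$. Here $\frac{\delta b}{\delta m}:\mathbb R^d\times\mathcal P_2(\mathbb R^d)\times\mathbb R^d\to\mathbb R^d$ is a linear functional derivative of $b$ in $m$: a map, continuous in $(x,m,y)$ (with $\mathcal W_2$ on $\mathcal P_2$), with $$\lim_{s\to0^+}\frac{b(x,(1-s)m+sm')-b(x,m)}{s}=\int_{\mathbb R^d}\frac{\delta b}{\delta m}(x,m,y)\,(m'-m)(dy)\qquad\text{for all }x\in\mathbb R^d,\ m,m'\in\mathcal P_2(\mathbb R^d).$$ For $\nu\in\mathcal P_2(\mathbb R^d)$ let $\mathcal A_\nu$ be the set of pairs $(\mu,a)$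 where $\mu:[t,T]\to\mathcal P_2(\mathbb R^d)$ is weakly continuous with $\mu_t=\nu$, the control $a:[t,T]\times\mathbb R^d\to\mathbb R^d$ is Borel and satisfies $\int_t^T\int_K|a_s|\,d\mu_s\,ds<\infty$ for every compact $K\subset\mathbb R^d$, and $$\partial_s\mu_s-\tfrac12\Delta\mu_s+\operatorname{div}\big((b(\cdot,\mu_s)+a_s)\mu_s\big)=0\quad\text{in }(t,T)\times\mathbb R^d$$ in the sense of distributions. For $\mu_T^*\in\mathcal P_2(\mathbb R^d)$ and $\epsilon>0$ put $$V_\epsilon=\inf\Big\{\tfrac12\int_t^T\!\!\int_{\mathbb R^d}|a_s|^2\,d\mu_s\,ds:\ (\mu,a)\in\mathcal A_\nu,\ \mathcal W_2(\mu_T,\mu_T^*)\le\epsilon\Big\},$$ $$V_0=\inf\Big\{\tfrac12\int_t^T\!\!\int_{\mathbb R^d}|a_s|^2\,d\mu_s\,ds:\ (\mu,a)\in\mathcal A_\nu,\ \mu_T=\mu_T^*\Big\},$$ with values in $[0,\infty]$ and $\inf\emptyset=+\infty$. Then, for all $\nu,\mu_T^*\in\mathcal P_2(\mathbb R^d)$,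 $\ \lim_{\epsilon\to0^+}V_\epsilon=V_0$ in $[0,\infty]$. -/

import Mathlib

open MeasureTheory Filter Topology Set
open scoped ENNReal ContDiff

noncomputable section

/-- The Euclidean space `ℝᵈ`. -/
abbrev Euc (d : ℕ) : Type := EuclideanSpace ℝ (Fin d)

/-- `𝒫₂(ℝᵈ)`: Borel probability measures on `ℝᵈ` with finite second moment. -/
def P2 (d : ℕ) : Type :=
  {m : ProbabilityMeasure (Euc d) // ∫⁻ x, ‖x‖ₑ ^ 2 ∂(m : Measure (Euc d)) < ⊤}

namespace P2

/-- The underlying measure. -/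
def meas {d : ℕ} (m : P2 d) : Measure (Euc d) := (m.1 : Measure (Euc d))

/-- The convex combination `(1 - s) m + s m'`, `s ∈ [0,1]`, of two elements of `𝒫₂(ℝᵈ)`. -/
def mix {d : ℕ} (m m' : P2 d) (s : Icc (0 : ℝ) 1) : P2 d :=
  ⟨⟨ENNReal.ofReal (1 - (s : ℝ)) • m.meas + ENNReal.ofReal (s : ℝ) • m'.meas, by
      have h1 : m.meas univ = 1 := m.1.2.measure_univ
      have h2 : m'.meas univ = 1 := m'.1.2.measure_univ
      constructor
      simp only [Measure.add_apply, Measure.smul_apply, smul_eq_mul, h1, h2, mul_one]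
      rw [← ENNReal.ofReal_add (by linarith [s.2.2]) s.2.1]
      simp⟩, by
    have h1 : ∫⁻ x, ‖x‖ₑ ^ 2 ∂m.meas < ⊤ := m.2
    have h2 : ∫⁻ x, ‖x‖ₑ ^ 2 ∂m'.meas < ⊤ := m'.2
    change ∫⁻ x, ‖x‖ₑ ^ 2 ∂(ENNReal.ofReal (1 - (s : ℝ)) • m.meas
      + ENNReal.ofReal (s : ℝ) • m'.meas) < ⊤
    rw [lintegral_add_measure, lintegral_smul_measure, lintegral_smul_measure]
    exact ENNReal.add_lt_top.2
      ⟨ENNReal.mul_lt_top ENNReal.ofReal_lt_top h1, ENNReal.mul_lt_top ENNReal.ofReal_lt_top h2⟩⟩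

end P2

/-- The quadratic Wasserstein distance
`𝒲₂(μ, ν) = (inf_π ∫ |x - y|² dπ(x, y))^(1/2)`, the infimum being over all couplings `π`
of `μ` and `ν`. -/
def wasserstein2 {d : ℕ} (μ ν : P2 d) : ℝ≥0∞ :=
  (⨅ (π : Measure (Euc d × Euc d)) (_ : π.map Prod.fst = μ.meas ∧ π.map Prod.snd = ν.meas),
    ∫⁻ z, edist z.1 z.2 ^ 2 ∂π) ^ (1 / 2 : ℝ)

/-- The filter of `𝒲₂`-neighbourhoods of `m` in `𝒫₂(ℝᵈ)`. -/
def nhdsW2 {d : ℕ} (m : P2 d) : Filter (P2 d) :=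
  comap (fun m' => wasserstein2 m' m) (𝓝 0)

/-- `f ∈ C²_c(B(0, R))`, `f` being extended by zero to all of `ℝᵈ`. -/
def IsCc2 {d : ℕ} (R : ℝ) (f : Euc d → Euc d) : Prop :=
  ContDiff ℝ 2 f ∧ HasCompactSupport f ∧ tsupport f ⊆ Metric.ball 0 R

/-- `D` is a version of the linear functional derivative `δF/δm : 𝒫₂(ℝᵈ) × ℝᵈ → ℝᵈ` of
`F : 𝒫₂(ℝᵈ) → ℝᵈ`:
`lim_{s → 0⁺} (F((1 - s) m + s m') - F(m)) / s = ∫ D(m, y) d(m' - m)(y)` for all `m, m'`.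
(The derivative is determined up to functions of `m` only; no normalization is imposed. The
integrals are those of compactly supported continuous functions where this is used.) -/
def IsLinearDerivative {d : ℕ} (F : P2 d → Euc d) (D : P2 d → Euc d → Euc d) : Prop :=
  ∀ m m' : P2 d,
    Tendsto (fun s : Icc (0 : ℝ) 1 => (s : ℝ)⁻¹ • (F (P2.mix m m' s) - F m)) (𝓝[>] 0)
      (𝓝 ((∫ y, D m y ∂m'.meas) - ∫ y, D m y ∂m.meas))

/-- The standing assumption on the drift `b : ℝᵈ × 𝒫₂(ℝᵈ) → ℝᵈ`: for some `R > 0` and every `m`,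
`b(·, m) ∈ C²_c(B(0, R))` and `δb/δm(x, m, ·) ∈ C²_c(B(0, R))`, where the linear derivative
`δb/δm` is, as part of its definition, (jointly) continuous, `𝒫₂(ℝᵈ)` carrying `𝒲₂`. -/
def DriftAssumption {d : ℕ} (b : Euc d → P2 d → Euc d) : Prop :=
  ∃ R : ℝ, 0 < R ∧ (∀ m, IsCc2 R (fun x => b x m)) ∧
    ∃ D : Euc d → P2 d → Euc d → Euc d,
      (∀ x, IsLinearDerivative (b x) (D x)) ∧
      (∀ x m y, Tendsto (fun p : Euc d × P2 d × Euc d => D p.1 p.2.1 p.2.2)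
        (𝓝 x ×ˢ nhdsW2 m ×ˢ 𝓝 y) (𝓝 (D x m y))) ∧
      ∀ x m, IsCc2 R (D x m)

/-- Smooth test functions with compact support in `(t, T) × ℝᵈ`. -/
def IsTestFunction {d : ℕ} (t T : ℝ) (φ : ℝ × Euc d → ℝ) : Prop :=
  ContDiff ℝ ∞ φ ∧ HasCompactSupport φ ∧ tsupport φ ⊆ Ioo t T ×ˢ univ

/-- `(μ, a)` solves the controlled nonlinear Fokker–Planck equation
`∂ₛμ - ½ Δμ + div((b(·, μₛ) + a) μ) = 0` on `(t, T) × ℝᵈ` in the sense of distributions. -/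
def SolvesFokkerPlanck {d : ℕ} (b : Euc d → P2 d → Euc d) (t T : ℝ)
    (μ : ℝ → P2 d) (a : ℝ → Euc d → Euc d) : Prop :=
  ∀ φ : ℝ × Euc d → ℝ, IsTestFunction t T φ →
    ∫ s in Ioo t T, ∫ x,
      (deriv (fun r => φ (r, x)) s
        + 1 / 2 * Laplacian.laplacian (fun y => φ (s, y)) x
        + inner ℝ (b x (μ s) + a s x) (gradient (fun y => φ (s, y)) x)) ∂(μ s).meas = 0

/-- The admissible pairs `(μ, a)` starting from `ν` at time `t`: the path `μ` of measures is weakly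
continuous on `[t, T]` with `μ_t = ν`, the control `a` is a Borel vector field, locally integrable
with respect to `μₛ(dx) ds`, and the controlled Fokker–Planck equation holds. -/
structure IsAdmissible {d : ℕ} (b : Euc d → P2 d → Euc d) (t T : ℝ) (ν : P2 d)
    (μ : ℝ → P2 d) (a : ℝ → Euc d → Euc d) : Prop where
  continuousOn : ContinuousOn (fun s => (μ s).1) (Icc t T)
  initial : μ t = ν
  measurable : Measurable (fun p : ℝ × Euc d => a p.1 p.2)
  locallyIntegrable : ∀ r : ℝ,
    ∫⁻ s in Icc t T, ∫⁻ x in Metric.closedBall 0 r, ‖a s x‖ₑ ∂(μ s).meas < ⊤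
  equation : SolvesFokkerPlanck b t T μ a

/-- The cost `½ ∫_t^T ⟨μₛ, |aₛ|²⟩ ds ∈ [0, ∞]`. -/
def controlCost {d : ℕ} (t T : ℝ) (μ : ℝ → P2 d) (a : ℝ → Euc d → Euc d) : ℝ≥0∞ :=
  1 / 2 * ∫⁻ s in Icc t T, ∫⁻ x, ‖a s x‖ₑ ^ 2 ∂(μ s).meas

/-- The minimal cost over admissible pairs starting from `ν` whose terminal measure lies in `S`
(equal to `∞` if there are none). -/
def minimalCost {d : ℕ} (b : Euc d → P2 d → Euc d) (t T : ℝ) (ν : P2 d) (S : Set (P2 d)) :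
    ℝ≥0∞ :=
  ⨅ (μ : ℝ → P2 d) (a : ℝ → Euc d → Euc d) (_ : IsAdmissible b t T ν μ a) (_ : μ T ∈ S),
    controlCost t T μ a

end

/-!
Enlarging the target set lowers the infimum, so `V_ε ≤ V_0` and `V_ε` increases as `ε` decreases.
The content is the lower bound, which is a compactness statement (`exists_isAdmissible_of_seq`): if
`(μⁿ, aⁿ)` are admissible pairs of cost at most `c`, then along a subsequence the paths converge
weakly at every time to a path `μ`, and some control `a` of cost at most `c` makes `(μ, a)`
admissible. Applied with `𝒲₂(μⁿ_T, μT) → 0` this produces a competitor for `V_0` of cost at most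
`c`, because `𝒲₂` convergence identifies weak limits (`eq_of_tendsto_of_wasserstein2_lt`).

*Dependence of the drift on the measure.* The functional derivative `δb/δm(x, m, ·)` vanishes
outside `B(0, R)`, and the mean value inequality along segments of measures bounds the variation of
`b(x, ·)` by that of its derivative (`IsLinearDerivative.norm_sub_le`). So `b(x, m)` only depends on
the image of `m` under the radial projection onto the closed ball of radius `R`
(`IsLinearDerivative.apply_proj`). On measures carried by a fixed ball, weak convergence implies
`𝒲₂` convergence (`tendsto_nhdsW2_of_tendsto`), and there the derivative is controlled by its joint
continuity. Therefore `b` is bounded and continuous for the weak topology on `𝒫₂`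
(`DriftAssumption.exists_bound`, `DriftAssumption.tendsto`).

*Compactness of the paths.* Testing the equation with a product of a function of time and a function
of space, and letting the former approach the indicator function of an interval, bounds the
increments of `s ↦ ∫ ψ dμₛ` (`IsAdmissible.abs_integral_sub_le`). This gives equicontinuity and, for
`ψ` a truncation of `|x|²`, a bound on the second moments which, for a given drift and time interval,
depends only on the cost and on the initial measure (`exists_secondMoment_bound`). Measures with
bounded second moments form a weakly compact set, so a diagonal argument over the rational times gives a convergent
subsequence (`exists_subseq_tendsto_path`).

*Recovering the control.* Tested with `φ`, the equation says that the integral over space-time of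
`∂ₛφ + ½ Δφ + b · ∇φ` is minus that of `a · ∇φ`, hence is at most `√(2c) ‖∇φ‖` in absolute value,
with the `L²` norm for the measure `μₛ(dx) ds`. Unlike the controls, both sides of this inequality
pass to the limit. For the limit path, the Hahn–Banach and Riesz theorems in `L²(μₛ(dx) ds)` then
yield a control of norm at most `√(2c)` for which the equation holds
(`exists_isAdmissible_of_abs_integral_le`). No lower semicontinuity of the cost and no convergence
of the controls is needed.
-/

noncomputable section

/-! ### Weak convergence and the Wasserstein distance -/

/-- If `μ = ∑ μᵢ` and `ν = ∑ νᵢ`, then `μ` and `ν` have a coupling which matches as much as possible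
of each `μᵢ` with the corresponding `νᵢ` and transports the remaining mass
`1 - ∑ min (μᵢ(X), νᵢ(X))` independently. -/
theorem exists_coupling_of_sum_eq {X : Type*} [MeasurableSpace X] {N : ℕ}
    (μ ν : Measure X) [IsProbabilityMeasure μ] [IsProbabilityMeasure ν] (μ' ν' : Fin N → Measure X)
    (hμ : ∑ i, μ' i = μ) (hν : ∑ i, ν' i = ν) (f : X × X → ℝ≥0∞) (c C : ℝ≥0∞)
    (hc : ∀ i, ∀ᵐ z ∂(μ' i).prod (ν' i), f z ≤ c) (hC : ∀ᵐ z ∂μ.prod ν, f z ≤ C) :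
    ∃ π : Measure (X × X), (π.map Prod.fst = μ ∧ π.map Prod.snd = ν) ∧
      ∫⁻ z, f z ∂π ≤ c + C * (1 - ∑ i, min (μ' i univ) (ν' i univ)) := by
  have hleμ : ∀ i, μ' i ≤ μ := fun i => by
    rw [← hμ]
    exact Finset.single_le_sum (f := μ') (fun _ _ => Measure.zero_le _) (Finset.mem_univ i)
  have hleν : ∀ i, ν' i ≤ ν := fun i => by
    rw [← hν]
    exact Finset.single_le_sum (f := ν') (fun _ _ => Measure.zero_le _) (Finset.mem_univ i)
  have hfμ : ∀ i, IsFiniteMeasure (μ' i) := fun i => isFiniteMeasure_of_le μ (hleμ i)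
  have hfν : ∀ i, IsFiniteMeasure (ν' i) := fun i => isFiniteMeasure_of_le ν (hleν i)
  set α : Fin N → ℝ≥0∞ := fun i => μ' i univ with hα
  set β : Fin N → ℝ≥0∞ := fun i => ν' i univ with hβ
  -- The part `M i • (μ' i).prod (ν' i)` of the coupling carries the mass `min (α i) (β i)`. When
  -- both masses vanish, `M i = ∞`, but then all the products below are zero.
  set M : Fin N → ℝ≥0∞ := fun i => (max (α i) (β i))⁻¹ with hM
  have hMβ : ∀ i, M i * β i ≤ 1 := fun i =>
    (mul_le_mul_right (le_max_right (α i) (β i)) _).trans (ENNReal.inv_mul_le_one _)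
  have hMα : ∀ i, M i * α i ≤ 1 := fun i =>
    (mul_le_mul_right (le_max_left (α i) (β i)) _).trans (ENNReal.inv_mul_le_one _)
  have hαt : ∀ i, α i ≠ ⊤ := fun i => measure_ne_top _ _
  have hβt : ∀ i, β i ≠ ⊤ := fun i => measure_ne_top _ _
  have hmin : ∀ i, M i * β i * α i = min (α i) (β i) := fun i => by
    rcases le_total (α i) (β i) with h | h
    · simp only [hM, max_eq_right h, min_eq_left h]
      rcases eq_or_ne (β i) 0 with h0 | h0
      · have : α i = 0 := le_antisymm (h0 ▸ h) zero_le
        simp [this]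
      · rw [ENNReal.inv_mul_cancel h0 (hβt i), one_mul]
    · simp only [hM, max_eq_left h, min_eq_right h]
      rcases eq_or_ne (α i) 0 with h0 | h0
      · have : β i = 0 := le_antisymm (h0 ▸ h) zero_le
        simp [this]
      · rw [mul_right_comm, ENNReal.inv_mul_cancel h0 (hαt i), one_mul]
  -- the parts of `μ` and `ν` which are not matched, both of mass `ρ`
  set μr : Measure X := ∑ i, (1 - M i * β i) • μ' i with hμr
  set νr : Measure X := ∑ i, (1 - M i * α i) • ν' i with hνr
  have hsμ : ∑ i, (M i * β i) • μ' i + μr = μ := by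
    rw [hμr, ← Finset.sum_add_distrib, ← hμ]
    refine Finset.sum_congr rfl fun i _ => ?_
    rw [← add_smul, add_tsub_cancel_of_le (hMβ i), one_smul]
  have hsν : ∑ i, (M i * α i) • ν' i + νr = ν := by
    rw [hνr, ← Finset.sum_add_distrib, ← hν]
    refine Finset.sum_congr rfl fun i _ => ?_
    rw [← add_smul, add_tsub_cancel_of_le (hMα i), one_smul]
  set ρ : ℝ≥0∞ := 1 - ∑ i, min (α i) (β i) with hρ
  have hSμ : ∑ i, min (α i) (β i) + μr univ = 1 := by
    have := congrArg (fun m : Measure X => m univ) hsμ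
    simp only [Measure.add_apply, Measure.finsetSum_apply, Measure.smul_apply, smul_eq_mul,
      measure_univ] at this
    rw [← this]; congr 1
    exact Finset.sum_congr rfl fun i _ => (hmin i).symm
  have hSν : ∑ i, min (α i) (β i) + νr univ = 1 := by
    have := congrArg (fun m : Measure X => m univ) hsν
    simp only [Measure.add_apply, Measure.finsetSum_apply, Measure.smul_apply, smul_eq_mul,
      measure_univ] at this
    rw [← this]; congr 1
    exact Finset.sum_congr rfl fun i _ => by rw [← hmin i, mul_right_comm]
  have hSt : ∑ i, min (α i) (β i) ≠ ⊤ :=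
    ne_top_of_le_ne_top ENNReal.one_ne_top (hSμ ▸ le_self_add)
  have hμρ : μr univ = ρ := by
    rw [hρ, ← hSμ, ENNReal.add_sub_cancel_left hSt]
  have hνρ : νr univ = ρ := by
    rw [hρ, ← hSν, ENNReal.add_sub_cancel_left hSt]
  have hρt : ρ ≠ ⊤ := ne_top_of_le_ne_top ENNReal.one_ne_top tsub_le_self
  have hμrle : μr ≤ μ := by rw [← hsμ]; exact Measure.le_add_left le_rfl
  have hνrle : νr ≤ ν := by rw [← hsν]; exact Measure.le_add_left le_rfl
  have : IsFiniteMeasure μr := isFiniteMeasure_of_le μ hμrle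
  have : IsFiniteMeasure νr := isFiniteMeasure_of_le ν hνrle
  have hrest : ∀ m : Measure X, m univ = ρ → (ρ⁻¹ * ρ) • m = m := fun m hm => by
    rcases eq_or_ne ρ 0 with h0 | h0
    · have : m = 0 := Measure.measure_univ_eq_zero.1 (hm.trans h0)
      simp [this]
    · rw [ENNReal.inv_mul_cancel h0 hρt, one_smul]
  refine ⟨∑ i, M i • (μ' i).prod (ν' i) + ρ⁻¹ • μr.prod νr, ⟨?_, ?_⟩, ?_⟩
  · rw [Measure.map_add _ _ measurable_fst, Measure.map_finset_sum measurable_fst.aemeasurable,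
      Measure.map_smul, Measure.map_fst_prod, hνρ, smul_smul, hrest μr hμρ]
    simp only [Measure.map_smul, Measure.map_fst_prod, smul_smul]
    exact hsμ
  · rw [Measure.map_add _ _ measurable_snd, Measure.map_finset_sum measurable_snd.aemeasurable,
      Measure.map_smul, Measure.map_snd_prod, hμρ, smul_smul, hrest νr hνρ]
    simp only [Measure.map_smul, Measure.map_snd_prod, smul_smul]
    exact hsν
  · rw [lintegral_add_measure, lintegral_finsetSum_measure, lintegral_smul_measure]
    have h1 : ∀ i, ∫⁻ z, f z ∂(M i • (μ' i).prod (ν' i)) ≤ c * min (α i) (β i) := fun i => by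
      rw [lintegral_smul_measure, smul_eq_mul, ← hmin i]
      calc M i * ∫⁻ z, f z ∂(μ' i).prod (ν' i)
          ≤ M i * ∫⁻ _, c ∂(μ' i).prod (ν' i) := by
            gcongr 1; exact lintegral_mono_ae (hc i)
        _ = c * (M i * β i * α i) := by
            rw [lintegral_const, ← univ_prod_univ, Measure.prod_prod]; ring
    have h2 : ∫⁻ z, f z ∂μr.prod νr ≤ C * (ρ * ρ) := by
      have hac : μr.prod νr ≪ μ.prod ν :=
        (Measure.absolutelyContinuous_of_le hμrle).prod (Measure.absolutelyContinuous_of_le hνrle)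
      calc ∫⁻ z, f z ∂μr.prod νr ≤ ∫⁻ _, C ∂μr.prod νr := lintegral_mono_ae (hac.ae_le hC)
        _ = C * (ρ * ρ) := by
            rw [lintegral_const, ← univ_prod_univ, Measure.prod_prod, hμρ, hνρ]
    refine add_le_add ?_ ?_
    · refine (Finset.sum_le_sum fun i _ => h1 i).trans ?_
      rw [← Finset.mul_sum]
      calc c * ∑ i, min (α i) (β i) ≤ c * 1 := by
            gcongr; rw [← hSμ]; exact le_self_add
        _ = c := mul_one c
    · rw [smul_eq_mul]
      calc ρ⁻¹ * ∫⁻ z, f z ∂μr.prod νr ≤ ρ⁻¹ * (C * (ρ * ρ)) := by gcongr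
        _ = C * ρ * (ρ⁻¹ * ρ) := by ring
        _ ≤ C * ρ * 1 := by gcongr; exact ENNReal.inv_mul_le_one _
        _ = C * ρ := mul_one _

/-- A compact set carries a finite continuous partition of unity with arbitrarily small supports. -/
theorem IsCompact.exists_partition_of_unity {X : Type*} [PseudoMetricSpace X] {K : Set X}
    (hK : IsCompact K) {δ : ℝ} (hδ : 0 < δ) :
    ∃ (N : ℕ) (φ : Fin N → BoundedContinuousFunction X NNReal),
      (∀ x ∈ K, ∑ i, φ i x = 1) ∧ ∀ i x y, φ i x ≠ 0 → φ i y ≠ 0 → dist x y ≤ δ := by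
  obtain ⟨s, -, hsf, hs⟩ := hK.finite_cover_balls (e := δ / 4) (by positivity)
  obtain ⟨N, x, hx⟩ : ∃ (N : ℕ) (x : Fin N → X), range x = s := by
    have := hsf.fintype
    exact ⟨Fintype.card s, fun i => (Fintype.equivFin s).symm i, by
      rw [range_comp' Subtype.val, (Fintype.equivFin s).symm.surjective.range_eq]; simp⟩
  -- Bumps of radius `δ / 2` at the centres of a covering by balls of radius `δ / 4`, normalized by
  -- their sum, which is at least `δ / 4` on `K`; the maximum avoids dividing by zero elsewhere.
  let g : Fin N → X → NNReal := fun i y => Real.toNNReal (δ / 2 - dist y (x i))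
  let e : NNReal := ⟨δ / 4, by positivity⟩
  have he : 0 < e := by change (0 : ℝ) < δ / 4; positivity
  let G : X → NNReal := fun y => max (∑ j, g j y) e
  have hg : ∀ i, Continuous (g i) := fun i => by fun_prop
  have hG : Continuous G := by fun_prop
  have hG0 : ∀ y, G y ≠ 0 := fun y => (lt_of_lt_of_le he (le_max_right _ _)).ne'
  have hle : ∀ i y, g i y / G y ≤ 1 := fun i y => by
    refine div_le_one_of_le₀ ?_ zero_le
    exact (Finset.single_le_sum (f := fun j => g j y) (fun _ _ => zero_le)
      (Finset.mem_univ i)).trans (le_max_left _ _)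
  have hsupp : ∀ i y, g i y / G y ≠ 0 → dist y (x i) ≤ δ / 2 := fun i y h => by
    by_contra! hcon
    exact h (by simp [g, Real.toNNReal_of_nonpos (by linarith : δ / 2 - dist y (x i) ≤ 0)])
  refine ⟨N, fun i => BoundedContinuousFunction.mkOfBound
    ⟨fun y => g i y / G y, (hg i).div₀ hG hG0⟩ 1 ?_, ?_, ?_⟩
  · intro y z
    have h1 : ((g i y / G y : NNReal) : ℝ) ≤ 1 := by exact_mod_cast hle i y
    have h2 : ((g i z / G z : NNReal) : ℝ) ≤ 1 := by exact_mod_cast hle i z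
    change |((g i y / G y : NNReal) : ℝ) - (g i z / G z : NNReal)| ≤ 1
    have h3 := (g i y / G y).2
    have h4 := (g i z / G z).2
    rw [abs_le]
    constructor <;> linarith
  · intro y hy
    change ∑ i, g i y / G y = 1
    rw [← Finset.sum_div]
    obtain ⟨z, hz, hyz⟩ := mem_iUnion₂.1 (hs hy)
    obtain ⟨i, rfl⟩ : z ∈ range x := hx ▸ hz
    have h1 : e ≤ g i y := by
      refine NNReal.coe_le_coe.1 ?_
      rw [Metric.mem_ball] at hyz
      rw [Real.coe_toNNReal _ (by linarith)]
      change δ / 4 ≤ _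
      linarith
    have h2 : e ≤ ∑ j, g j y := h1.trans (Finset.single_le_sum (f := fun j => g j y)
      (fun _ _ => zero_le) (Finset.mem_univ i))
    have : G y = ∑ j, g j y := max_eq_left h2
    rw [this]
    exact div_self (lt_of_lt_of_le he h2).ne'
  · intro i y z hy hz
    have h1 := hsupp i y hy
    have h2 := hsupp i z hz
    calc dist y z ≤ dist y (x i) + dist z (x i) := dist_triangle_right _ _ _
      _ ≤ δ := by linarith

/-- On measures carried by a fixed ball, weak convergence implies convergence in `𝒲₂`. -/
theorem tendsto_nhdsW2_of_tendsto {d : ℕ} {ι : Type*} {l : Filter ι} {m : ι → P2 d} {m₀ : P2 d}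
    {r : ℝ} (hm : ∀ i, (m i).meas (Metric.closedBall 0 r)ᶜ = 0)
    (hm₀ : m₀.meas (Metric.closedBall 0 r)ᶜ = 0)
    (h : Tendsto (fun i => (m i).1) l (𝓝 m₀.1)) : Tendsto m l (nhdsW2 m₀) := by
  have hprob : ∀ m : P2 d, IsProbabilityMeasure m.meas := fun m => m.1.2
  rw [nhdsW2, tendsto_comap_iff]
  suffices H : Tendsto (fun i => ⨅ (π : Measure (Euc d × Euc d))
      (_ : π.map Prod.fst = (m i).meas ∧ π.map Prod.snd = m₀.meas),
      ∫⁻ z, edist z.1 z.2 ^ 2 ∂π) l (𝓝 0) by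
    have := (ENNReal.continuous_rpow_const (y := (1 / 2 : ℝ))).tendsto 0 |>.comp H
    rwa [ENNReal.zero_rpow_of_pos (by norm_num)] at this
  set C : ℝ≥0∞ := ENNReal.ofReal (2 * r) ^ 2 with hCdef
  have hCt : C ≠ ⊤ := ENNReal.pow_ne_top ENNReal.ofReal_ne_top
  -- Split both measures by a partition of unity of mesh `δ`: pieces with the same index are coupled
  -- at distance at most `δ`, and the unmatched mass tends to zero because the masses converge.
  have key : ∀ δ : ℝ, 0 < δ → ∃ ρ : ι → ℝ≥0∞, Tendsto ρ l (𝓝 0) ∧ ∀ i,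
      ⨅ (π : Measure (Euc d × Euc d))
      (_ : π.map Prod.fst = (m i).meas ∧ π.map Prod.snd = m₀.meas),
      ∫⁻ z, edist z.1 z.2 ^ 2 ∂π ≤ ENNReal.ofReal δ ^ 2 + C * ρ i := by
    intro δ hδ
    obtain ⟨N, φ, hφ1, hφ2⟩ :=
      (isCompact_closedBall (0 : Euc d) r).exists_partition_of_unity hδ
    let w : P2 d → Fin N → Measure (Euc d) := fun m j => m.meas.withDensity fun x => (φ j x : ℝ≥0∞)
    have hφm : ∀ j, Measurable fun x => (φ j x : ℝ≥0∞) := fun j =>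
      (ENNReal.continuous_coe.comp (φ j).continuous).measurable
    have hw : ∀ m : P2 d, m.meas (Metric.closedBall 0 r)ᶜ = 0 → ∑ j, w m j = m.meas := by
      intro m hm
      have h1 : ∑ j, w m j = m.meas.withDensity (∑ j, fun x => (φ j x : ℝ≥0∞)) := by
        ext s hs
        rw [withDensity_apply _ hs, Measure.finsetSum_apply]
        simp only [w, withDensity_apply _ hs, Finset.sum_apply]
        rw [lintegral_finsetSum _ (fun j _ => hφm j)]
      rw [h1]
      conv_rhs => rw [← withDensity_one (μ := m.meas)]
      refine withDensity_congr_ae ?_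
      have : ∀ᵐ x ∂m.meas, x ∈ Metric.closedBall (0 : Euc d) r := hm
      filter_upwards [this] with x hx
      rw [Finset.sum_apply, Pi.one_apply, ← ENNReal.ofNNReal_finsetSum, hφ1 x hx, ENNReal.coe_one]
    have hwu : ∀ m j, w m j univ = ∫⁻ x, (φ j x : ℝ≥0∞) ∂m.meas := fun m j => by
      simp [w, withDensity_apply]
    refine ⟨fun i => 1 - ∑ j, min (w (m i) j univ) (w m₀ j univ), ?_, fun i => ?_⟩
    · have h1 : ∀ j, Tendsto (fun i => w (m i) j univ) l (𝓝 (w m₀ j univ)) := fun j => by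
        simp only [hwu]
        exact ProbabilityMeasure.tendsto_iff_forall_lintegral_tendsto.1 h (φ j)
      have h2 : Tendsto (fun i => ∑ j, min (w (m i) j univ) (w m₀ j univ)) l
          (𝓝 (∑ j, min (w m₀ j univ) (w m₀ j univ))) :=
        tendsto_finsetSum _ fun j _ => (h1 j).min tendsto_const_nhds
      have h3 : ∑ j, min (w m₀ j univ) (w m₀ j univ) = 1 := by
        simp only [min_self]
        rw [← Measure.finsetSum_apply, hw m₀ hm₀]
        exact measure_univ
      rw [h3] at h2
      have := ENNReal.Tendsto.sub (tendsto_const_nhds (x := (1 : ℝ≥0∞))) h2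
        (Or.inl ENNReal.one_ne_top)
      rwa [tsub_self] at this
    · have hp1 : ∀ j, ∀ᵐ z ∂(w (m i) j).prod (w m₀ j),
          edist z.1 z.2 ^ 2 ≤ ENNReal.ofReal δ ^ 2 := by
        intro j
        have h1 : ∀ m : P2 d, ∀ᵐ x ∂w m j, φ j x ≠ 0 := fun m => by
          have : ∀ᵐ x ∂w m j, (φ j x : ℝ≥0∞) ≠ 0 := by
            simp only [w]
            rw [ae_withDensity_iff (hφm j)]
            exact ae_of_all _ fun x hx => hx
          filter_upwards [this] with x hx
          simpa using hx
        have := hprob (m i)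
        have := hprob m₀
        have : SFinite (w m₀ j) := by simp only [w]; infer_instance
        filter_upwards [Measure.quasiMeasurePreserving_fst.ae (h1 (m i)),
          Measure.quasiMeasurePreserving_snd.ae (h1 m₀)] with z hz1 hz2
        gcongr
        rw [edist_dist]
        exact ENNReal.ofReal_le_ofReal (hφ2 j _ _ hz1 hz2)
      have hp2 : ∀ᵐ z ∂(m i).meas.prod m₀.meas, edist z.1 z.2 ^ 2 ≤ C := by
        have h1 : ∀ᵐ x ∂(m i).meas, x ∈ Metric.closedBall (0 : Euc d) r := hm i
        have h2 : ∀ᵐ x ∂m₀.meas, x ∈ Metric.closedBall (0 : Euc d) r := hm₀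
        have := hprob m₀
        filter_upwards [Measure.quasiMeasurePreserving_fst.ae h1,
          Measure.quasiMeasurePreserving_snd.ae h2] with z hz1 hz2
        rw [hCdef]
        gcongr
        rw [edist_dist]
        refine ENNReal.ofReal_le_ofReal ?_
        rw [mem_closedBall_zero_iff] at hz1 hz2
        calc dist z.1 z.2 ≤ ‖z.1‖ + ‖z.2‖ := dist_le_norm_add_norm _ _
          _ ≤ 2 * r := by linarith
      have := hprob (m i)
      have := hprob m₀
      obtain ⟨π, hπ, hπ'⟩ := exists_coupling_of_sum_eq (m i).meas m₀.meas (w (m i)) (w m₀)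
        (hw _ (hm i)) (hw _ hm₀) (fun z => edist z.1 z.2 ^ 2) (ENNReal.ofReal δ ^ 2) C hp1 hp2
      exact (iInf₂_le π hπ).trans hπ'
  rw [ENNReal.tendsto_nhds_zero]
  intro ε hε
  obtain ⟨δ, hδ, hδε⟩ : ∃ δ : ℝ, 0 < δ ∧ ENNReal.ofReal δ ^ 2 < ε := by
    have : Tendsto (fun δ : ℝ => ENNReal.ofReal δ ^ 2) (𝓝[>] 0) (𝓝 0) := by
      have : Continuous fun δ : ℝ => ENNReal.ofReal δ ^ 2 :=
        (ENNReal.continuous_pow 2).comp ENNReal.continuous_ofReal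
      simpa using (this.tendsto 0).mono_left nhdsWithin_le_nhds
    obtain ⟨δ, h1, h2⟩ := ((this.eventually (gt_mem_nhds hε)).and self_mem_nhdsWithin).exists
    exact ⟨δ, h2, h1⟩
  obtain ⟨ρ, hρ, hle⟩ := key δ hδ
  have h3 : Tendsto (fun i => ENNReal.ofReal δ ^ 2 + C * ρ i) l (𝓝 (ENNReal.ofReal δ ^ 2)) := by
    have := (ENNReal.Tendsto.const_mul hρ (Or.inr hCt)).const_add (ENNReal.ofReal δ ^ 2)
    simpa using this
  filter_upwards [h3.eventually (gt_mem_nhds hδε)] with i hi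
  exact (hle i).trans hi.le

/-! ### Continuity of the drift for the weak topology -/

namespace P2

instance {d : ℕ} (m : P2 d) : IsProbabilityMeasure m.meas := m.1.2

theorem ext_meas {d : ℕ} {m m' : P2 d} (h : m.meas = m'.meas) : m = m' :=
  Subtype.ext (Subtype.ext h)

theorem meas_mix {d : ℕ} (m m' : P2 d) (s : Icc (0 : ℝ) 1) :
    (mix m m' s).meas =
      ENNReal.ofReal (1 - (s : ℝ)) • m.meas + ENNReal.ofReal (s : ℝ) • m'.meas := rfl

theorem integral_mix {d : ℕ} {E : Type*} [NormedAddCommGroup E] [NormedSpace ℝ E] (m m' : P2 d)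
    (s : Icc (0 : ℝ) 1) {f : Euc d → E} (hf : Integrable f m.meas) (hf' : Integrable f m'.meas) :
    ∫ x, f x ∂(mix m m' s).meas
      = (1 - (s : ℝ)) • ∫ x, f x ∂m.meas + (s : ℝ) • ∫ x, f x ∂m'.meas := by
  rw [meas_mix, integral_add_measure (hf.smul_measure ENNReal.ofReal_ne_top)
    (hf'.smul_measure ENNReal.ofReal_ne_top), integral_smul_measure, integral_smul_measure,
    ENNReal.toReal_ofReal s.2.1, ENNReal.toReal_ofReal (by linarith [s.2.2])]

theorem mix_zero {d : ℕ} (m m' : P2 d) : mix m m' 0 = m := by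
  apply ext_meas; simp [meas_mix]

theorem mix_one {d : ℕ} (m m' : P2 d) : mix m m' 1 = m' := by
  apply ext_meas; simp [meas_mix]

theorem mix_symm {d : ℕ} (m m' : P2 d) {s s' : Icc (0 : ℝ) 1} (h : (s' : ℝ) = 1 - s) :
    mix m m' s = mix m' m s' := by
  apply ext_meas; simp [meas_mix, h, add_comm]

theorem mix_mix {d : ℕ} (m m' : P2 d) {s r u : Icc (0 : ℝ) 1}
    (h : (u : ℝ) = s + r * (1 - s)) : mix (mix m m' s) m' r = mix m m' u := by
  apply ext_meas
  have h1 : (0 : ℝ) ≤ 1 - r := by linarith [r.2.2]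
  have h2 : (0 : ℝ) ≤ 1 - s := by linarith [s.2.2]
  rw [meas_mix, meas_mix, meas_mix, smul_add, smul_smul, smul_smul, add_assoc, ← add_smul,
    ← ENNReal.ofReal_mul h1, ← ENNReal.ofReal_mul h1,
    ← ENNReal.ofReal_add (mul_nonneg h1 s.2.1) r.2.1, h]
  congr 3 <;> ring

end P2

theorem IsCc2.continuous {d : ℕ} {R : ℝ} {f : Euc d → Euc d} (hf : IsCc2 R f) : Continuous f :=
  hf.1.continuous

theorem IsCc2.integrable {d : ℕ} {R : ℝ} {f : Euc d → Euc d} (hf : IsCc2 R f)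
    (m : Measure (Euc d)) [IsFiniteMeasure m] : Integrable f m :=
  hf.continuous.integrable_of_hasCompactSupport hf.2.1

theorem IsCc2.eq_zero {d : ℕ} {R : ℝ} {f : Euc d → Euc d} (hf : IsCc2 R f) {x : Euc d}
    (hx : R ≤ ‖x‖) : f x = 0 := by
  by_contra h
  have := hf.2.2 (subset_tsupport f h)
  rw [mem_ball_zero_iff] at this
  linarith

/-- The derivative of `F` along the segment from `m` to `m'`, at an arbitrary point of it. -/
theorem IsLinearDerivative.hasDerivWithinAt {d : ℕ} {F : P2 d → Euc d} {D : P2 d → Euc d → Euc d}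
    (hF : IsLinearDerivative F D) (hD : ∀ m (n : P2 d), Integrable (D m) n.meas) (m m' : P2 d)
    {s : ℝ} (hs : s ∈ Ico (0 : ℝ) 1) :
    HasDerivWithinAt (fun u => F (P2.mix m m' (projIcc 0 1 zero_le_one u)))
      ((∫ y, D (P2.mix m m' (projIcc 0 1 zero_le_one s)) y ∂m'.meas)
        - ∫ y, D (P2.mix m m' (projIcc 0 1 zero_le_one s)) y ∂m.meas) (Ici s) s := by
  have h1s : 0 < 1 - s := by linarith [hs.2]
  set σ : Icc (0 : ℝ) 1 := projIcc 0 1 zero_le_one s with hσ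
  have hσs : (σ : ℝ) = s := by
    rw [hσ, projIcc_of_mem zero_le_one ⟨hs.1, hs.2.le⟩]
  set n := P2.mix m m' σ with hn
  rw [hasDerivWithinAt_iff_tendsto_slope, Ici_sdiff_left]
  let r : ℝ → Icc (0 : ℝ) 1 := fun u => projIcc 0 1 zero_le_one ((u - s) / (1 - s))
  have hr : Tendsto r (𝓝[>] s) (𝓝[>] 0) := by
    have hr0 : r s = 0 := by
      simp only [r, sub_self, zero_div]
      exact projIcc_left zero_le_one
    have hc : Continuous r := continuous_projIcc.comp (by fun_prop)
    refine tendsto_nhdsWithin_iff.2 ⟨?_, ?_⟩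
    · have := (hc.tendsto s).mono_left (nhdsWithin_le_nhds (s := Ioi s))
      rwa [hr0] at this
    · filter_upwards [self_mem_nhdsWithin] with u hu
      rw [mem_Ioi, ← Subtype.coe_lt_coe]
      have : 0 < (u - s) / (1 - s) := div_pos (sub_pos.2 hu) h1s
      simp only [r, coe_projIcc]
      simpa using this
  have hlim := ((hF n m').comp hr).const_smul (1 - s)⁻¹
  have hint : (1 - s)⁻¹ • ((∫ y, D n y ∂m'.meas) - ∫ y, D n y ∂n.meas)
      = (∫ y, D n y ∂m'.meas) - ∫ y, D n y ∂m.meas := by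
    conv_lhs => rw [hn, P2.integral_mix m m' σ (hD _ m) (hD _ m'), hσs, ← hn]
    rw [inv_smul_eq_iff₀ h1s.ne', smul_sub, sub_smul, sub_smul, one_smul, one_smul]
    abel
  rw [hint] at hlim
  refine hlim.congr' ?_
  filter_upwards [Ioo_mem_nhdsGT hs.2] with u hu
  have hu0 : 0 < u - s := sub_pos.2 hu.1
  have hmem : (u - s) / (1 - s) ∈ Icc (0 : ℝ) 1 :=
    ⟨(div_pos hu0 h1s).le, (div_le_one h1s).2 (by linarith [hu.2])⟩
  have hru : (r u : ℝ) = (u - s) / (1 - s) := by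
    simp only [r]; rw [projIcc_of_mem zero_le_one hmem]
  have hmix : P2.mix n m' (r u) = P2.mix m m' (projIcc 0 1 zero_le_one u) := by
    refine P2.mix_mix m m' ?_
    rw [hru, hσs, projIcc_of_mem zero_le_one ⟨by linarith [hs.1, hu.1], hu.2.le⟩]
    field_simp
    ring
  simp only [Function.comp_apply, slope_def_module, hmix, hru, smul_smul]
  congr 1
  field_simp

/-- The mean value inequality along the segment from `m` to `m'`. -/
theorem IsLinearDerivative.norm_sub_le {d : ℕ} {F : P2 d → Euc d} {D : P2 d → Euc d → Euc d}
    (hF : IsLinearDerivative F D) (hD : ∀ m (n : P2 d), Integrable (D m) n.meas) (m m' : P2 d)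
    {C : ℝ} (hC : ∀ s : Icc (0 : ℝ) 1,
      ‖(∫ y, D (P2.mix m m' s) y ∂m'.meas) - ∫ y, D (P2.mix m m' s) y ∂m.meas‖ ≤ C) :
    ‖F m' - F m‖ ≤ C := by
  have hcont : ContinuousOn (fun u => F (P2.mix m m' (projIcc 0 1 zero_le_one u))) (Icc 0 1) := by
    intro s hs
    have hright : ContinuousWithinAt
        (fun u => F (P2.mix m m' (projIcc 0 1 zero_le_one u))) (Icc s 1) s := by
      rcases hs.2.eq_or_lt with h | h
      · rw [h, Icc_self]; exact continuousWithinAt_singleton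
      · exact (hF.hasDerivWithinAt hD m m' ⟨hs.1, h⟩).continuousWithinAt.mono Icc_subset_Ici_self
    -- left continuity is right continuity along the reversed segment
    have hleft : ContinuousWithinAt
        (fun u => F (P2.mix m m' (projIcc 0 1 zero_le_one u))) (Icc 0 s) s := by
      rcases hs.1.eq_or_lt with h | h
      · rw [← h, Icc_self]; exact continuousWithinAt_singleton
      · have h1 := (hF.hasDerivWithinAt hD m' m (s := 1 - s)
          ⟨by linarith [hs.2], by linarith⟩).continuousWithinAt
        have h2 : ContinuousWithinAt (fun u : ℝ => 1 - u) (Icc 0 s) s := by fun_prop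
        have h3 := h1.comp (x := s) h2 (fun u hu => by
          simp only [mem_Ici]; linarith [hu.2])
        refine h3.congr_of_mem (fun u hu => ?_) ⟨h.le, le_rfl⟩
        have hu1 : u ∈ Icc (0 : ℝ) 1 := ⟨hu.1, hu.2.trans hs.2⟩
        have hu2 : 1 - u ∈ Icc (0 : ℝ) 1 := ⟨by linarith [hu1.2], by linarith [hu1.1]⟩
        simp only [Function.comp_apply]
        rw [P2.mix_symm m m' (s' := projIcc 0 1 zero_le_one (1 - u))]
        rw [projIcc_of_mem _ hu1, projIcc_of_mem _ hu2]
    have := hleft.union hright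
    rwa [Icc_union_Icc_eq_Icc hs.1 hs.2] at this
  have := norm_image_sub_le_of_norm_deriv_right_le_segment hcont
    (fun s hs => hF.hasDerivWithinAt hD m m' hs) (fun s _ => hC _) 1 ⟨zero_le_one, le_rfl⟩
  rw [projIcc_left, projIcc_right, sub_zero, mul_one] at this
  simpa only [← Icc.mk_zero, ← Icc.mk_one, P2.mix_one, P2.mix_zero] using
    (show ‖F (P2.mix m m' 1) - F (P2.mix m m' 0)‖ ≤ C from this)

/-- The nearest-point retraction of `ℝᵈ` onto the closed ball of radius `R`. -/
def radialProj {d : ℕ} (R : ℝ) (x : Euc d) : Euc d := (R / max R ‖x‖) • x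

theorem continuous_radialProj {d : ℕ} {R : ℝ} (hR : 0 < R) :
    Continuous (radialProj R : Euc d → Euc d) := by
  unfold radialProj
  exact (continuous_const.div (by fun_prop) fun x => (lt_max_of_lt_left hR).ne').smul continuous_id

theorem radialProj_of_le {d : ℕ} {R : ℝ} (hR : 0 < R) {x : Euc d} (hx : ‖x‖ ≤ R) :
    radialProj R x = x := by
  rw [radialProj, max_eq_left hx, div_self hR.ne', one_smul]

theorem norm_radialProj_of_le {d : ℕ} {R : ℝ} (hR : 0 < R) {x : Euc d} (hx : R ≤ ‖x‖) :
    ‖radialProj R x‖ = R := by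
  have : 0 < ‖x‖ := hR.trans_le hx
  rw [radialProj, max_eq_right hx, norm_smul, Real.norm_of_nonneg (by positivity)]
  field_simp

theorem norm_radialProj_le {d : ℕ} {R : ℝ} (hR : 0 < R) (x : Euc d) : ‖radialProj R x‖ ≤ R := by
  rcases le_total ‖x‖ R with h | h
  · rwa [radialProj_of_le hR h]
  · exact (norm_radialProj_of_le hR h).le

theorem IsCc2.comp_radialProj {d : ℕ} {R : ℝ} (hR : 0 < R) {f : Euc d → Euc d} (hf : IsCc2 R f)
    (x : Euc d) : f (radialProj R x) = f x := by
  rcases le_total ‖x‖ R with h | h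
  · rw [radialProj_of_le hR h]
  · rw [hf.eq_zero h, hf.eq_zero (norm_radialProj_of_le hR h).ge]

/-- The image of a measure under the retraction onto the closed ball of radius `R`. -/
def P2.proj {d : ℕ} (R : ℝ) (hR : 0 < R) (m : P2 d) : P2 d :=
  ⟨m.1.map (continuous_radialProj hR).measurable.aemeasurable, by
    rw [ProbabilityMeasure.toMeasure_map,
      lintegral_map (by fun_prop) (continuous_radialProj hR).measurable]
    calc ∫⁻ x, ‖radialProj R x‖ₑ ^ 2 ∂(m.1 : Measure (Euc d))
        ≤ ∫⁻ _, ENNReal.ofReal R ^ 2 ∂(m.1 : Measure (Euc d)) := by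
          refine lintegral_mono fun x => ?_
          gcongr
          rw [← ofReal_norm]
          exact ENNReal.ofReal_le_ofReal (norm_radialProj_le hR x)
      _ < ⊤ := by
          simp only [lintegral_const, measure_univ, mul_one]
          exact ENNReal.pow_lt_top ENNReal.ofReal_lt_top⟩

theorem P2.meas_proj {d : ℕ} {R : ℝ} (hR : 0 < R) (m : P2 d) :
    (P2.proj R hR m).meas = m.meas.map (radialProj R) := rfl

theorem P2.meas_proj_compl {d : ℕ} {R : ℝ} (hR : 0 < R) (m : P2 d) :
    (P2.proj R hR m).meas (Metric.closedBall 0 R)ᶜ = 0 := by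
  rw [P2.meas_proj, Measure.map_apply (continuous_radialProj hR).measurable
    Metric.isClosed_closedBall.measurableSet.compl]
  convert measure_empty (μ := m.meas)
  ext x
  simpa using norm_radialProj_le hR x

theorem P2.tendsto_proj {d : ℕ} {R : ℝ} (hR : 0 < R) {ι : Type*} {l : Filter ι} {m : ι → P2 d}
    {m₀ : P2 d} (h : Tendsto (fun i => (m i).1) l (𝓝 m₀.1)) :
    Tendsto (fun i => (P2.proj R hR (m i)).1) l (𝓝 (P2.proj R hR m₀).1) :=
  ProbabilityMeasure.tendsto_map_of_tendsto_of_continuous _ _ h (continuous_radialProj hR)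

/-- As the linear derivative of `F` vanishes outside a ball, `F` does not see where the mass outside
this ball is located. -/
theorem IsLinearDerivative.apply_proj {d : ℕ} {F : P2 d → Euc d} {D : P2 d → Euc d → Euc d}
    (hF : IsLinearDerivative F D) {R : ℝ} (hR : 0 < R) (hD : ∀ m, IsCc2 R (D m)) (m : P2 d) :
    F (P2.proj R hR m) = F m := by
  rw [← sub_eq_zero, ← norm_le_zero_iff]
  refine hF.norm_sub_le (fun m n => (hD m).integrable _) _ _ fun s => ?_
  rw [P2.meas_proj, integral_map (continuous_radialProj hR).measurable.aemeasurable
    (hD _).continuous.aestronglyMeasurable]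
  simp only [(hD _).comp_radialProj hR, sub_self, norm_zero, le_refl]

/-- Weak convergence tested on a continuous, compactly supported, vector-valued function. -/
theorem tendsto_integral_of_hasCompactSupport {d : ℕ} {ι : Type*} {l : Filter ι} {m : ι → P2 d}
    {m₀ : P2 d} (h : Tendsto (fun i => (m i).1) l (𝓝 m₀.1)) {f : Euc d → Euc d}
    (hf : Continuous f) (hf' : HasCompactSupport f) :
    Tendsto (fun i => ∫ x, f x ∂(m i).meas) l (𝓝 (∫ x, f x ∂m₀.meas)) := by
  have hint : ∀ m : P2 d, Integrable f m.meas := fun m =>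
    hf.integrable_of_hasCompactSupport hf'
  have key : ∀ (m : P2 d) (j : Fin d), (∫ x, f x ∂m.meas) j = ∫ x, f x j ∂m.meas := fun m j =>
    ((EuclideanSpace.proj (𝕜 := ℝ) j).integral_comp_comm (hint m)).symm
  have hcoord : ∀ j, Tendsto (fun i => (∫ x, f x ∂(m i).meas) j) l (𝓝 ((∫ x, f x ∂m₀.meas) j)) := by
    intro j
    simp only [key]
    obtain ⟨C, hC⟩ := hf'.exists_bound_of_continuous hf
    let g : BoundedContinuousFunction (Euc d) ℝ :=
      BoundedContinuousFunction.ofNormedAddCommGroup (fun x => f x j)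
        ((EuclideanSpace.proj (𝕜 := ℝ) j).continuous.comp hf) C
        fun x => (PiLp.norm_apply_le (f x) j).trans (hC x)
    exact ProbabilityMeasure.tendsto_iff_forall_integral_tendsto.1 h g
  have := (PiLp.continuous_toLp 2 (fun _ : Fin d => ℝ)).tendsto (fun j => (∫ x, f x ∂m₀.meas) j)
  exact this.comp (tendsto_pi_nhds.2 hcoord)

/-- Under the standing assumption the drift is jointly continuous, the measure variable carrying the
weak topology. -/
theorem DriftAssumption.tendsto {d : ℕ} {b : Euc d → P2 d → Euc d} (hb : DriftAssumption b)
    {ι : Type*} {l : Filter ι} {m : ι → P2 d} {m₀ : P2 d} {x : ι → Euc d} {x₀ : Euc d}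
    (hm : Tendsto (fun i => (m i).1) l (𝓝 m₀.1)) (hx : Tendsto x l (𝓝 x₀)) :
    Tendsto (fun i => b (x i) (m i)) l (𝓝 (b x₀ m₀)) := by
  obtain ⟨R, hR, hbR, D, hD, hDc, hDR⟩ := hb
  have hproj : ∀ x m, b x m = b x (P2.proj R hR m) := fun x m =>
    ((hD x).apply_proj hR (hDR x) m).symm
  simp only [hproj x₀ m₀, fun i => hproj (x i) (m i)]
  have hn := P2.tendsto_proj hR hm
  have hns : ∀ i, (P2.proj R hR (m i)).meas (Metric.closedBall 0 R)ᶜ = 0 :=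
    fun i => P2.meas_proj_compl hR _
  have hns₀ : (P2.proj R hR m₀).meas (Metric.closedBall 0 R)ᶜ = 0 := P2.meas_proj_compl hR _
  generalize P2.proj R hR m₀ = n₀ at hn hns₀
  generalize hgen : (fun i => P2.proj R hR (m i)) = n
  have hgen' : ∀ i, P2.proj R hR (m i) = n i := fun i => congrFun hgen i
  simp only [hgen'] at hn hns ⊢
  -- the measures on the segments from `n₀` to `n i` converge to `n₀`, uniformly on the segment
  have hmix : Tendsto (fun p : ι × Icc (0 : ℝ) 1 => P2.mix n₀ (n p.1) p.2) (l ×ˢ ⊤)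
      (nhdsW2 n₀) := by
    refine tendsto_nhdsW2_of_tendsto (r := R) (fun p => ?_) hns₀ ?_
    · simp [P2.meas_mix, hns₀, hns]
    · rw [ProbabilityMeasure.tendsto_iff_forall_integral_tendsto] at hn ⊢
      intro f
      have hint : ∀ m : P2 d, Integrable (fun x => f x) m.meas := fun m => f.integrable _
      have h1 := (hn f).comp (tendsto_fst (f := l) (g := (⊤ : Filter (Icc (0 : ℝ) 1))))
      rw [tendsto_iff_norm_sub_tendsto_zero] at h1 ⊢
      refine squeeze_zero (fun _ => norm_nonneg _) (fun p => ?_) h1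
      have h2 := P2.integral_mix n₀ (n p.1) p.2 (hint n₀) (hint (n p.1))
      have h3 : (∫ x, f x ∂(P2.mix n₀ (n p.1) p.2).meas) - ∫ x, f x ∂n₀.meas
          = (p.2 : ℝ) • ((∫ x, f x ∂(n p.1).meas) - ∫ x, f x ∂n₀.meas) := by
        rw [h2]; simp only [smul_eq_mul]; ring
      change ‖(∫ x, f x ∂(P2.mix n₀ (n p.1) p.2).meas) - ∫ x, f x ∂n₀.meas‖
        ≤ ‖(∫ x, f x ∂(n p.1).meas) - ∫ x, f x ∂n₀.meas‖
      rw [h3, norm_smul, Real.norm_of_nonneg p.2.2.1]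
      exact mul_le_of_le_one_left (norm_nonneg _) p.2.2.2
  rw [tendsto_iff_norm_sub_tendsto_zero]
  have hbx : Tendsto (fun i => ‖b (x i) n₀ - b x₀ n₀‖) l (𝓝 0) :=
    tendsto_iff_norm_sub_tendsto_zero.1 (((hbR n₀).continuous.tendsto x₀).comp hx)
  have hD₀ : Tendsto (fun i => ‖(∫ y, D x₀ n₀ y ∂(n i).meas) - ∫ y, D x₀ n₀ y ∂n₀.meas‖) l (𝓝 0) :=
    tendsto_iff_norm_sub_tendsto_zero.1
      (tendsto_integral_of_hasCompactSupport hn (hDR x₀ n₀).continuous (hDR x₀ n₀).2.1)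
  rw [Metric.tendsto_nhds]
  intro ε hε
  have hU : {p : (Euc d × P2 d) × Euc d | ‖D p.1.1 p.1.2 p.2 - D x₀ n₀ p.2‖ < ε / 8} ∈
      (𝓝 x₀ ×ˢ nhdsW2 n₀) ×ˢ 𝓝ˢ (Metric.closedBall (0 : Euc d) R) := by
    refine (isCompact_closedBall _ _).mem_prod_nhdsSet_of_forall fun y _ => ?_
    have h1 := (hDc x₀ n₀ y).comp (tendsto_prodAssoc (f := 𝓝 x₀) (g := nhdsW2 n₀) (h := 𝓝 y))
    have h2 : Tendsto (fun p : (Euc d × P2 d) × Euc d => D x₀ n₀ p.2)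
        ((𝓝 x₀ ×ˢ nhdsW2 n₀) ×ˢ 𝓝 y) (𝓝 (D x₀ n₀ y)) :=
      ((hDR x₀ n₀).continuous.tendsto y).comp tendsto_snd
    have h3 := (h1.sub h2).norm
    rw [sub_self, norm_zero] at h3
    exact h3.eventually (gt_mem_nhds (by positivity))
  obtain ⟨U, hU1, V, hV, hUV⟩ := Filter.mem_prod_iff.1 hU
  have hVK : Metric.closedBall (0 : Euc d) R ⊆ V := subset_of_mem_nhdsSet hV
  have hev : ∀ᶠ p in l ×ˢ (⊤ : Filter (Icc (0 : ℝ) 1)), (x p.1, P2.mix n₀ (n p.1) p.2) ∈ U :=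
    ((hx.comp tendsto_fst).prodMk hmix) hU1
  obtain ⟨A, hA, B, hB, hAB⟩ := Filter.mem_prod_iff.1 hev
  rw [mem_top] at hB
  subst hB
  filter_upwards [hA, hbx.eventually (gt_mem_nhds (show (0 : ℝ) < ε / 4 by positivity)),
    hD₀.eventually (gt_mem_nhds (show (0 : ℝ) < ε / 4 by positivity))] with i hi hi1 hi2
  have hmv : ‖b (x i) (n i) - b (x i) n₀‖ ≤ ε / 2 := by
    refine (hD (x i)).norm_sub_le (fun m q => (hDR _ m).integrable _) _ _ fun s => ?_
    set E := D (x i) (P2.mix n₀ (n i) s) with hE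
    have hclose : ∀ q : P2 d, q.meas (Metric.closedBall 0 R)ᶜ = 0 →
        ‖(∫ y, E y ∂q.meas) - ∫ y, D x₀ n₀ y ∂q.meas‖ ≤ ε / 8 := by
      intro q hq
      rw [← integral_sub ((hDR _ _).integrable _) ((hDR _ _).integrable _)]
      have hq' : ∀ᵐ y ∂q.meas, y ∈ Metric.closedBall (0 : Euc d) R := hq
      have := norm_integral_le_of_norm_le_const (μ := q.meas) (C := ε / 8)
        (f := fun y => E y - D x₀ n₀ y) (by
          filter_upwards [hq'] with y hy
          have h1 : (i, s) ∈ A ×ˢ (univ : Set (Icc (0 : ℝ) 1)) := ⟨hi, mem_univ _⟩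
          have h2 : ((x i, P2.mix n₀ (n i) s), y) ∈ U ×ˢ V := ⟨hAB h1, hVK hy⟩
          exact (hUV h2).le)
      simpa using this
    have h1 := hclose (n i) (hns i)
    have h2 := hclose n₀ hns₀
    calc ‖(∫ y, E y ∂(n i).meas) - ∫ y, E y ∂n₀.meas‖
        = ‖((∫ y, E y ∂(n i).meas) - ∫ y, D x₀ n₀ y ∂(n i).meas)
            + ((∫ y, D x₀ n₀ y ∂(n i).meas) - ∫ y, D x₀ n₀ y ∂n₀.meas)
            - ((∫ y, E y ∂n₀.meas) - ∫ y, D x₀ n₀ y ∂n₀.meas)‖ := by congr 1; abel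
      _ ≤ ε / 8 + ε / 4 + ε / 8 :=
          (norm_sub_le _ _).trans (add_le_add ((norm_add_le _ _).trans (add_le_add h1 hi2.le)) h2)
      _ = ε / 2 := by ring
  rw [dist_zero_right, norm_norm]
  calc ‖b (x i) (n i) - b x₀ n₀‖ ≤ ‖b (x i) (n i) - b (x i) n₀‖ + ‖b (x i) n₀ - b x₀ n₀‖ :=
        norm_sub_le_norm_sub_add_norm_sub _ _ _
    _ < ε := by linarith

/-! ### Probability measures with bounded second moments -/

/-- The probability measures on `ℝᵈ` with second moment at most `M`. -/
def secondMomentLE (d : ℕ) (M : ℝ≥0∞) : Set (ProbabilityMeasure (Euc d)) :=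
  {m | ∫⁻ x, ‖x‖ₑ ^ 2 ∂(m : Measure (Euc d)) ≤ M}

theorem mem_secondMomentLE_iff {d : ℕ} {M : ℝ≥0∞} {m : ProbabilityMeasure (Euc d)} :
    m ∈ secondMomentLE d M ↔
      ∀ k : ℕ, ∫⁻ x, min (‖x‖ₑ ^ 2) (k : ℝ≥0∞) ∂(m : Measure (Euc d)) ≤ M := by
  have h : ∫⁻ x, ‖x‖ₑ ^ 2 ∂(m : Measure (Euc d))
      = ⨆ k : ℕ, ∫⁻ x, min (‖x‖ₑ ^ 2) (k : ℝ≥0∞) ∂(m : Measure (Euc d)) := by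
    rw [← lintegral_iSup]
    · refine lintegral_congr fun x => ?_
      rw [← inf_iSup_eq, ENNReal.iSup_natCast, min_top_right]
    · intro k
      fun_prop
    · intro i j hij x
      exact min_le_min_left _ (by exact_mod_cast hij)
  rw [secondMomentLE, mem_ofPred_eq, h, iSup_le_iff]

theorem isClosed_secondMomentLE (d : ℕ) (M : ℝ≥0∞) : IsClosed (secondMomentLE d M) := by
  have : secondMomentLE d M = ⋂ k : ℕ, {m : ProbabilityMeasure (Euc d) |
      ∫⁻ x, min (‖x‖ₑ ^ 2) (k : ℝ≥0∞) ∂(m : Measure (Euc d)) ≤ M} := by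
    ext m
    rw [mem_secondMomentLE_iff, mem_iInter]
    rfl
  rw [this]
  refine isClosed_iInter fun k => isClosed_le ?_ continuous_const
  let f : BoundedContinuousFunction (Euc d) NNReal := BoundedContinuousFunction.mkOfBound
    ⟨fun x => min (‖x‖₊ ^ 2) k, by fun_prop⟩ k (fun x y => by
      have h1 : (min (‖x‖₊ ^ 2) (k : NNReal) : NNReal) ≤ k := min_le_right _ _
      have h2 : (min (‖y‖₊ ^ 2) (k : NNReal) : NNReal) ≤ k := min_le_right _ _
      have h1' : ((min (‖x‖₊ ^ 2) (k : NNReal) : NNReal) : ℝ) ≤ k := by exact_mod_cast h1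
      have h2' : ((min (‖y‖₊ ^ 2) (k : NNReal) : NNReal) : ℝ) ≤ k := by exact_mod_cast h2
      have h3 := NNReal.coe_nonneg (min (‖x‖₊ ^ 2) (k : NNReal))
      have h4 := NNReal.coe_nonneg (min (‖y‖₊ ^ 2) (k : NNReal))
      change |((min (‖x‖₊ ^ 2) (k : NNReal) : NNReal) : ℝ)
        - (min (‖y‖₊ ^ 2) (k : NNReal) : NNReal)| ≤ k
      rw [abs_le]; constructor <;> linarith)
  have hf : ∀ x, ((f x : NNReal) : ℝ≥0∞) = min (‖x‖ₑ ^ 2) (k : ℝ≥0∞) := fun x => by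
    change ((min (‖x‖₊ ^ 2) (k : NNReal) : NNReal) : ℝ≥0∞) = _
    rw [ENNReal.coe_min]; simp [enorm]
  have := ProbabilityMeasure.continuous_lintegral_boundedContinuousFunction (X := Euc d) f
  simpa only [hf] using this

theorem isCompact_secondMomentLE (d : ℕ) {M : ℝ≥0∞} (hM : M ≠ ⊤) :
    IsCompact (secondMomentLE d M) := by
  rw [← (isClosed_secondMomentLE d M).closure_eq]
  refine isCompact_closure_of_isTightMeasureSet
    (isTightMeasureSet_of_tendsto_measure_norm_gt ?_)
  have hlim : Tendsto (fun r : ℝ => M / ENNReal.ofReal r ^ 2) atTop (𝓝 0) := by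
    have h1 : Tendsto (fun r : ℝ => ENNReal.ofReal r ^ 2) atTop (𝓝 ⊤) := by
      have := ((ENNReal.continuous_pow 2).tendsto ⊤).comp ENNReal.tendsto_ofReal_atTop
      simpa [Function.comp_def] using this
    have := ENNReal.Tendsto.const_div h1 (Or.inr hM)
    simpa using this
  refine tendsto_of_tendsto_of_tendsto_of_le_of_le' tendsto_const_nhds hlim
    (Eventually.of_forall fun _ => zero_le) ?_
  filter_upwards [eventually_gt_atTop 0] with r hr
  refine iSup₂_le fun μ hμ => ?_
  obtain ⟨m, hm, rfl⟩ := hμ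
  rw [ENNReal.le_div_iff_mul_le (Or.inl (by simp [hr])) (Or.inl (by simp)), mul_comm]
  refine le_trans ?_ (le_trans (mul_meas_ge_le_lintegral (μ := (m : Measure (Euc d)))
    (f := fun x => ‖x‖ₑ ^ 2) (by fun_prop) (ENNReal.ofReal r ^ 2)) hm)
  gcongr
  intro hy
  rw [← ofReal_norm]
  exact pow_le_pow_left' (ENNReal.ofReal_le_ofReal (le_of_lt hy)) 2

/-- Probability measures are determined by their integrals of smooth compactly supported functions:
by monotone approximation of indicators of bounded open sets. -/
theorem probabilityMeasure_ext_of_integral_contDiff {d : ℕ} {μ ν : ProbabilityMeasure (Euc d)}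
    (h : ∀ φ : Euc d → ℝ, ContDiff ℝ ∞ φ → HasCompactSupport φ →
      ∫ x, φ x ∂(μ : Measure (Euc d)) = ∫ x, φ x ∂(ν : Measure (Euc d))) : μ = ν := by
  have hbdd : ∀ U : Set (Euc d), IsOpen U → Bornology.IsBounded U →
      (μ : Measure (Euc d)) U = (ν : Measure (Euc d)) U := by
    intro U hU hUb
    obtain ⟨f, hfs, hf, hf01⟩ := hU.exists_contDiff_support_eq (n := ⊤)
    have hf0 : ∀ x, 0 ≤ f x := fun x => (hf01 (mem_range_self x)).1
    let g : ℕ → Euc d → ℝ := fun n x => Real.smoothTransition (n * f x)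
    have hgs : ∀ n, ContDiff ℝ ∞ (g n) := fun n =>
      Real.smoothTransition.contDiff.comp (contDiff_const.mul hf)
    have hgc : ∀ n, HasCompactSupport (g n) := fun n => by
      refine HasCompactSupport.of_support_subset_isCompact hUb.isCompact_closure ?_
      refine subset_trans ?_ subset_closure
      intro x hx
      rw [← hfs]
      intro h0
      exact hx (by simp [g, h0])
    have hlim : ∀ m : ProbabilityMeasure (Euc d),
        Tendsto (fun n => ∫ x, g n x ∂(m : Measure (Euc d))) atTop
          (𝓝 ((m : Measure (Euc d)).real U)) := by
      intro m
      rw [← integral_indicator_one hU.measurableSet]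
      refine tendsto_integral_of_dominated_convergence (fun _ => 1)
        (fun n => (hgs n).continuous.aestronglyMeasurable) (integrable_const _) ?_ ?_
      · intro n
        refine ae_of_all _ fun x => ?_
        rw [Real.norm_of_nonneg (Real.smoothTransition.nonneg _)]
        exact Real.smoothTransition.le_one _
      · refine ae_of_all _ fun x => ?_
        by_cases hx : x ∈ U
        · have hfx : 0 < f x := lt_of_le_of_ne (hf0 x) (Ne.symm (by rw [← hfs] at hx; exact hx))
          rw [indicator_of_mem hx, Pi.one_apply]
          refine tendsto_const_nhds.congr' ?_
          have := (tendsto_natCast_atTop_atTop (R := ℝ)).atTop_mul_const hfx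
          filter_upwards [this.eventually_ge_atTop 1] with n hn
          exact (Real.smoothTransition.one_of_one_le hn).symm
        · have hfx : f x = 0 := by
            by_contra h0
            exact hx (hfs ▸ h0)
          simp [g, hfx, hx]
    have h1 := hlim μ
    have h2 := hlim ν
    simp only [h _ (hgs _) (hgc _)] at h1
    exact (measureReal_eq_measureReal_iff).1 (tendsto_nhds_unique h1 h2)
  have hopen : ∀ U : Set (Euc d), IsOpen U →
      (μ : Measure (Euc d)) U = (ν : Measure (Euc d)) U := by
    intro U hU
    have hUn : U = ⋃ n : ℕ, U ∩ Metric.ball 0 n := by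
      rw [← inter_iUnion, Metric.iUnion_ball_nat, inter_univ]
    have hmono : Monotone fun n : ℕ => U ∩ Metric.ball (0 : Euc d) n := fun i j hij =>
      inter_subset_inter_right _ (Metric.ball_subset_ball (by exact_mod_cast hij))
    rw [hUn, hmono.measure_iUnion, hmono.measure_iUnion]
    refine iSup_congr fun n => hbdd _ (hU.inter Metric.isOpen_ball)
      (Metric.isBounded_ball.subset inter_subset_right)
  refine ProbabilityMeasure.toMeasure_injective ?_
  refine ext_of_generate_finite {U : Set (Euc d) | IsOpen U} BorelSpace.measurable_eq
    isPiSystem_isOpen (fun U hU => hopen U hU) ?_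
  rw [measure_univ (μ := (μ : Measure (Euc d))), measure_univ (μ := (ν : Measure (Euc d)))]

theorem continuous_integral_of_hasCompactSupport {d : ℕ} {φ : Euc d → ℝ} (hφ : Continuous φ)
    (hφ' : HasCompactSupport φ) :
    Continuous fun m : ProbabilityMeasure (Euc d) => ∫ x, φ x ∂(m : Measure (Euc d)) := by
  obtain ⟨C, hC⟩ := hφ'.exists_bound_of_continuous hφ
  exact ProbabilityMeasure.continuous_integral_boundedContinuousFunction
    (BoundedContinuousFunction.ofNormedAddCommGroup φ hφ C hC)

/-- In a compact set of probability measures, convergence can be tested on smooth compactly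
supported functions. -/
theorem tendsto_of_forall_integral_contDiff {d : ℕ} {ι : Type*} {l : Filter ι}
    {K : Set (ProbabilityMeasure (Euc d))} (hK : IsCompact K)
    {u : ι → ProbabilityMeasure (Euc d)} (hu : ∀ i, u i ∈ K) {m : ProbabilityMeasure (Euc d)}
    (h : ∀ φ : Euc d → ℝ, ContDiff ℝ ∞ φ → HasCompactSupport φ →
      Tendsto (fun i => ∫ x, φ x ∂(u i : Measure (Euc d))) l
        (𝓝 (∫ x, φ x ∂(m : Measure (Euc d))))) : Tendsto u l (𝓝 m) := by
  refine hK.tendsto_nhds_of_unique_mapClusterPt (Eventually.of_forall hu) fun p _ hp => ?_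
  refine probabilityMeasure_ext_of_integral_contDiff fun φ hφ hφ' => ?_
  have h1 : MapClusterPt (∫ x, φ x ∂(p : Measure (Euc d))) l
      (fun i => ∫ x, φ x ∂(u i : Measure (Euc d))) :=
    hp.continuousAt_comp
      (continuous_integral_of_hasCompactSupport hφ.continuous hφ').continuousAt
  exact eq_of_nhds_neBot ((h1.neBot).mono (inf_le_inf_left _ (h φ hφ hφ')))

/-- In a compact set of probability measures, a sequence converges as soon as its integrals of
smooth compactly supported functions are Cauchy sequences. -/
theorem exists_tendsto_of_forall_cauchySeq {d : ℕ} {K : Set (ProbabilityMeasure (Euc d))}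
    (hK : IsCompact K) {u : ℕ → ProbabilityMeasure (Euc d)} (hu : ∀ i, u i ∈ K)
    (h : ∀ φ : Euc d → ℝ, ContDiff ℝ ∞ φ → HasCompactSupport φ →
      CauchySeq (fun i => ∫ x, φ x ∂(u i : Measure (Euc d)))) :
    ∃ m ∈ K, Tendsto u atTop (𝓝 m) := by
  obtain ⟨m, hm, σ, hσ, hlim⟩ := hK.tendsto_subseq hu
  refine ⟨m, hm, tendsto_of_forall_integral_contDiff hK hu fun φ hφ hφ' => ?_⟩
  refine tendsto_nhds_of_cauchySeq_of_subseq (h φ hφ hφ') hσ.tendsto_atTop ?_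
  exact ((continuous_integral_of_hasCompactSupport hφ.continuous hφ').tendsto m).comp hlim

/-- The drift is bounded: it factors through the measures carried by a fixed ball, which form a
weakly compact set. -/
theorem DriftAssumption.exists_bound {d : ℕ} {b : Euc d → P2 d → Euc d} (hb : DriftAssumption b) :
    ∃ B : ℝ, 0 ≤ B ∧ ∀ x m, ‖b x m‖ ≤ B := by
  obtain ⟨R, hR, hbR, D, hD, hDc, hDR⟩ := id hb
  by_contra! hcon
  have hcon' : ∀ k : ℕ, ∃ x m, (k : ℝ) < ‖b x m‖ := fun k => hcon k (Nat.cast_nonneg k)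
  choose x m hxm using hcon'
  have hx : ∀ k, x k ∈ Metric.closedBall (0 : Euc d) R := fun k => by
    rw [mem_closedBall_zero_iff]
    by_contra! h
    have := hxm k
    rw [(hbR (m k)).eq_zero h.le, norm_zero] at this
    exact absurd this (not_lt.2 (Nat.cast_nonneg k))
  let n : ℕ → P2 d := fun k => P2.proj R hR (m k)
  have hn : ∀ k, (n k).1 ∈ secondMomentLE d (ENNReal.ofReal R ^ 2) := fun k => by
    have h1 : ∀ᵐ y ∂(n k).meas, y ∈ Metric.closedBall (0 : Euc d) R := P2.meas_proj_compl hR _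
    change ∫⁻ y, ‖y‖ₑ ^ 2 ∂(n k).meas ≤ _
    calc ∫⁻ y, ‖y‖ₑ ^ 2 ∂(n k).meas ≤ ∫⁻ _, ENNReal.ofReal R ^ 2 ∂(n k).meas := by
          refine lintegral_mono_ae ?_
          filter_upwards [h1] with y hy
          gcongr
          rw [← ofReal_norm]
          exact ENNReal.ofReal_le_ofReal (mem_closedBall_zero_iff.1 hy)
      _ = ENNReal.ofReal R ^ 2 := by simp
  obtain ⟨p, -, σ, hσ, hp⟩ := (((isCompact_secondMomentLE d
    (ENNReal.pow_ne_top ENNReal.ofReal_ne_top)).prod (isCompact_closedBall _ _)).tendsto_subseq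
      (x := fun k => ((n k).1, x k)) fun k => mk_mem_prod (hn k) (hx k))
  have hp1 : Tendsto (fun k => (n (σ k)).1) atTop (𝓝 p.1) := (continuous_fst.tendsto p).comp hp
  have hp2 : Tendsto (fun k => x (σ k)) atTop (𝓝 p.2) := (continuous_snd.tendsto p).comp hp
  have hpK : p.1 ∈ secondMomentLE d (ENNReal.ofReal R ^ 2) :=
    (isClosed_secondMomentLE _ _).mem_of_tendsto hp1 (Eventually.of_forall fun k => hn _)
  let q : P2 d := ⟨p.1, lt_of_le_of_lt hpK (ENNReal.pow_lt_top ENNReal.ofReal_lt_top)⟩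
  have hlim := (hb.tendsto (m := fun k => n (σ k)) (m₀ := q) hp1 hp2).norm
  refine not_tendsto_nhds_of_tendsto_atTop ?_ _ hlim
  refine tendsto_atTop_mono (fun k => ?_)
    ((tendsto_natCast_atTop_atTop (R := ℝ)).comp hσ.tendsto_atTop)
  have h1 : b (x (σ k)) (n (σ k)) = b (x (σ k)) (m (σ k)) :=
    (hD (x (σ k))).apply_proj hR (hDR _) (m (σ k))
  rw [h1]
  exact (hxm (σ k)).le

/-- Weak convergence passes to the limit in the nonlinear transport term. -/
theorem DriftAssumption.tendsto_integral_inner {d : ℕ} {b : Euc d → P2 d → Euc d}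
    (hb : DriftAssumption b) {ι : Type*} {l : Filter ι} {m : ι → P2 d} {m₀ : P2 d}
    (hm : Tendsto (fun i => (m i).1) l (𝓝 m₀.1)) {g : Euc d → Euc d} (hg : Continuous g)
    (hg' : HasCompactSupport g) :
    Tendsto (fun i => ∫ x, inner ℝ (b x (m i)) (g x) ∂(m i).meas) l
      (𝓝 (∫ x, inner ℝ (b x m₀) (g x) ∂m₀.meas)) := by
  obtain ⟨G, hG⟩ := hg'.exists_bound_of_continuous hg
  have hG0 : 0 ≤ G := (norm_nonneg _).trans (hG 0)
  obtain ⟨R, hR, hbR, -⟩ := id hb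
  have hcont : ∀ m, Continuous fun x => inner ℝ (b x m) (g x) := fun m =>
    (hbR m).continuous.inner hg
  have hsupp : ∀ m, HasCompactSupport fun x => inner ℝ (b x m) (g x) := fun m =>
    hg'.mono' (fun x hx => subset_tsupport g (fun h => hx (by simp [h])))
  have hint : ∀ m n : P2 d, Integrable (fun x => inner ℝ (b x m) (g x)) n.meas := fun m n =>
    (hcont m).integrable_of_hasCompactSupport (hsupp m)
  have h1 : Tendsto (fun i => ∫ x, inner ℝ (b x m₀) (g x) ∂(m i).meas) l
      (𝓝 (∫ x, inner ℝ (b x m₀) (g x) ∂m₀.meas)) :=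
    ((continuous_integral_of_hasCompactSupport (hcont m₀) (hsupp m₀)).tendsto m₀.1).comp hm
  -- the drifts converge uniformly on the support of `g`
  have h2 : Tendsto (fun i => (∫ x, inner ℝ (b x (m i)) (g x) ∂(m i).meas)
      - ∫ x, inner ℝ (b x m₀) (g x) ∂(m i).meas) l (𝓝 0) := by
    rw [Metric.tendsto_nhds]
    intro ε hε
    have hδ : 0 < ε / (2 * (G + 1)) := by positivity
    have hU : {p : ι × Euc d | ‖b p.2 (m p.1) - b p.2 m₀‖ < ε / (2 * (G + 1))}
        ∈ l ×ˢ 𝓝ˢ (tsupport g) := by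
      refine IsCompact.mem_prod_nhdsSet_of_forall hg' fun x _ => ?_
      have h3 := hb.tendsto (m := fun p : ι × Euc d => m p.1) (x := fun p => p.2)
        (l := l ×ˢ 𝓝 x) (hm.comp tendsto_fst) tendsto_snd
      have h4 : Tendsto (fun p : ι × Euc d => b p.2 m₀) (l ×ˢ 𝓝 x) (𝓝 (b x m₀)) :=
        ((hbR m₀).continuous.tendsto x).comp tendsto_snd
      have h5 := (h3.sub h4).norm
      rw [sub_self, norm_zero] at h5
      exact h5.eventually (gt_mem_nhds hδ)
    obtain ⟨A, hA, V, hV, hAV⟩ := Filter.mem_prod_iff.1 hU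
    filter_upwards [hA] with i hi
    rw [← integral_sub (hint _ _) (hint _ _), dist_zero_right]
    have := norm_integral_le_of_norm_le_const (μ := (m i).meas) (C := ε / 2)
      (f := fun x => inner ℝ (b x (m i)) (g x) - inner ℝ (b x m₀) (g x)) (by
        refine ae_of_all _ fun x => ?_
        rw [← inner_sub_left]
        by_cases hx : x ∈ tsupport g
        · have hmem : (i, x) ∈ A ×ˢ V := ⟨hi, subset_of_mem_nhdsSet hV hx⟩
          have h3 : ‖b x (m i) - b x m₀‖ < ε / (2 * (G + 1)) := by
            have h4 := hAV hmem
            rwa [mem_ofPred_eq] at h4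
          calc ‖inner ℝ (b x (m i) - b x m₀) (g x)‖ ≤ ‖b x (m i) - b x m₀‖ * ‖g x‖ :=
                norm_inner_le_norm _ _
            _ ≤ ε / (2 * (G + 1)) * (G + 1) := by
                gcongr; linarith [hG x]
            _ = ε / 2 := by field_simp
        · rw [image_eq_zero_of_notMem_tsupport hx, inner_zero_right, norm_zero]
          positivity)
    rw [probReal_univ, mul_one] at this
    linarith
  have := h2.add h1
  simpa using this

/-! ### Partial derivatives of test functions -/

/-- The time derivative of a function of time and space. -/
def timeDeriv {d : ℕ} (φ : ℝ × Euc d → ℝ) (z : ℝ × Euc d) : ℝ := deriv (fun r => φ (r, z.2)) z.1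

/-- The Laplacian in space of a function of time and space. -/
def spaceLap {d : ℕ} (φ : ℝ × Euc d → ℝ) (z : ℝ × Euc d) : ℝ :=
  Laplacian.laplacian (fun y => φ (z.1, y)) z.2

/-- The gradient in space of a function of time and space. -/
def spaceGrad {d : ℕ} (φ : ℝ × Euc d → ℝ) (z : ℝ × Euc d) : Euc d :=
  gradient (fun y => φ (z.1, y)) z.2

theorem laplacian_eq_sum_fderiv {d : ℕ} {f : Euc d → ℝ} (hf : ContDiff ℝ ∞ f) (x : Euc d) :
    Laplacian.laplacian f x =
      ∑ i, fderiv ℝ (fun y => fderiv ℝ f y (EuclideanSpace.basisFun _ ℝ i)) x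
        (EuclideanSpace.basisFun (Fin d) ℝ i) := by
  rw [InnerProductSpace.laplacian_eq_iteratedFDeriv_orthonormalBasis f
    (EuclideanSpace.basisFun (Fin d) ℝ)]
  refine Finset.sum_congr rfl fun i _ => ?_
  rw [iteratedFDeriv_two_apply]
  have h1 : DifferentiableAt ℝ (fderiv ℝ f) x :=
    ((hf.fderiv_right (m := 1) (by norm_cast)).differentiable one_ne_zero) x
  rw [fderiv_clm_apply h1 (differentiableAt_const _)]
  simp

theorem hasCompactSupport_sum {X ι : Type*} [TopologicalSpace X] [R1Space X] [Fintype ι]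
    {f : ι → X → ℝ} (hf : ∀ i, HasCompactSupport (f i)) :
    HasCompactSupport fun x => ∑ i, f i x := by
  refine HasCompactSupport.of_support_subset_isCompact (isCompact_iUnion fun i => hf i)
    fun x hx => ?_
  obtain ⟨i, -, hi⟩ := Finset.exists_ne_zero_of_sum_ne_zero hx
  exact mem_iUnion.2 ⟨i, subset_tsupport _ hi⟩

section Calculus

variable {d : ℕ} {φ ψ : ℝ × Euc d → ℝ}

theorem timeDeriv_eq (hφ : ContDiff ℝ ∞ φ) (z : ℝ × Euc d) :
    timeDeriv φ z = fderiv ℝ φ z (1, 0) := by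
  have h1 : HasFDerivAt φ (fderiv ℝ φ z) z := (hφ.differentiable (by simp) z).hasFDerivAt
  have h2 : HasDerivAt (fun r : ℝ => (r, z.2)) ((1 : ℝ), (0 : Euc d)) z.1 :=
    (hasDerivAt_id z.1).prodMk (hasDerivAt_const z.1 z.2)
  exact (h1.comp_hasDerivAt z.1 h2).deriv

theorem fderiv_space (hφ : ContDiff ℝ ∞ φ) (s : ℝ) (x : Euc d) :
    fderiv ℝ (fun y => φ (s, y)) x
      = (fderiv ℝ φ (s, x)).comp (ContinuousLinearMap.inr ℝ ℝ (Euc d)) := by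
  have h1 : HasFDerivAt φ (fderiv ℝ φ (s, x)) (s, x) := (hφ.differentiable (by simp) _).hasFDerivAt
  have h2 : HasFDerivAt (fun y : Euc d => (s, y)) (ContinuousLinearMap.inr ℝ ℝ (Euc d)) x :=
    hasFDerivAt_prodMk_right s x
  exact (h1.comp x h2).fderiv

theorem spaceGrad_eq (hφ : ContDiff ℝ ∞ φ) (z : ℝ × Euc d) :
    spaceGrad φ z = (InnerProductSpace.toDual ℝ (Euc d)).symm
      ((fderiv ℝ φ z).comp (ContinuousLinearMap.inr ℝ ℝ (Euc d))) := by
  rw [spaceGrad, gradient, fderiv_space hφ]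

theorem contDiff_fderiv_apply_const {E : Type*} [NormedAddCommGroup E] [NormedSpace ℝ E]
    {φ : E → ℝ} (hφ : ContDiff ℝ ∞ φ) (e : E) : ContDiff ℝ ∞ fun w => fderiv ℝ φ w e :=
  (hφ.fderiv_right (m := ∞) (by simp)).clm_apply contDiff_const

theorem spaceLap_eq (hφ : ContDiff ℝ ∞ φ) (z : ℝ × Euc d) :
    spaceLap φ z = ∑ i, fderiv ℝ (fun w => fderiv ℝ φ w (0, EuclideanSpace.basisFun _ ℝ i)) z
      (0, EuclideanSpace.basisFun (Fin d) ℝ i) := by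
  have h1 : ContDiff ℝ ∞ fun y => φ (z.1, y) := hφ.comp (by fun_prop)
  rw [spaceLap, laplacian_eq_sum_fderiv h1]
  refine Finset.sum_congr rfl fun i _ => ?_
  simp only [fderiv_space hφ, ContinuousLinearMap.comp_apply, ContinuousLinearMap.inr_apply]
  have h2 := fderiv_space
    (contDiff_fderiv_apply_const hφ (0, EuclideanSpace.basisFun _ ℝ i)) z.1 z.2
  simp only [h2, ContinuousLinearMap.comp_apply, ContinuousLinearMap.inr_apply]

theorem continuous_timeDeriv (hφ : ContDiff ℝ ∞ φ) : Continuous (timeDeriv φ) := by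
  rw [funext (timeDeriv_eq hφ)]
  exact (contDiff_fderiv_apply_const hφ _).continuous

theorem continuous_spaceLap (hφ : ContDiff ℝ ∞ φ) : Continuous (spaceLap φ) := by
  rw [funext (spaceLap_eq hφ)]
  exact continuous_finsetSum _ fun i _ =>
    (contDiff_fderiv_apply_const (contDiff_fderiv_apply_const hφ _) _).continuous

theorem continuous_spaceGrad (hφ : ContDiff ℝ ∞ φ) : Continuous (spaceGrad φ) := by
  rw [funext (spaceGrad_eq hφ)]
  exact (InnerProductSpace.toDual ℝ (Euc d)).symm.continuous.comp
    ((hφ.continuous_fderiv (by simp)).clm_comp continuous_const)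

theorem hasCompactSupport_timeDeriv (hφ : ContDiff ℝ ∞ φ) (hc : HasCompactSupport φ) :
    HasCompactSupport (timeDeriv φ) := by
  rw [funext (timeDeriv_eq hφ)]
  exact hc.fderiv_apply ℝ _

theorem hasCompactSupport_spaceLap (hφ : ContDiff ℝ ∞ φ) (hc : HasCompactSupport φ) :
    HasCompactSupport (spaceLap φ) := by
  rw [funext (spaceLap_eq hφ)]
  exact hasCompactSupport_sum fun i => (hc.fderiv_apply ℝ _).fderiv_apply ℝ _

theorem hasCompactSupport_spaceGrad (hφ : ContDiff ℝ ∞ φ) (hc : HasCompactSupport φ) :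
    HasCompactSupport (spaceGrad φ) := by
  rw [funext (spaceGrad_eq hφ)]
  refine (hc.fderiv ℝ).mono (fun z hz h => hz ?_)
  simp [h]

theorem timeDeriv_add (hφ : ContDiff ℝ ∞ φ) (hψ : ContDiff ℝ ∞ ψ) (z : ℝ × Euc d) :
    timeDeriv (φ + ψ) z = timeDeriv φ z + timeDeriv ψ z := by
  rw [timeDeriv_eq (show ContDiff ℝ ∞ (φ + ψ) from hφ.add hψ), timeDeriv_eq hφ, timeDeriv_eq hψ,
    fderiv_add (hφ.differentiable (by simp) z) (hψ.differentiable (by simp) z)]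
  rfl

theorem spaceGrad_add (hφ : ContDiff ℝ ∞ φ) (hψ : ContDiff ℝ ∞ ψ) (z : ℝ × Euc d) :
    spaceGrad (φ + ψ) z = spaceGrad φ z + spaceGrad ψ z := by
  rw [spaceGrad_eq (show ContDiff ℝ ∞ (φ + ψ) from hφ.add hψ), spaceGrad_eq hφ, spaceGrad_eq hψ,
    fderiv_add (hφ.differentiable (by simp) z) (hψ.differentiable (by simp) z),
    ContinuousLinearMap.add_comp, map_add]

theorem spaceLap_add (hφ : ContDiff ℝ ∞ φ) (hψ : ContDiff ℝ ∞ ψ) (z : ℝ × Euc d) :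
    spaceLap (φ + ψ) z = spaceLap φ z + spaceLap ψ z := by
  have h1 : ContDiff ℝ ∞ fun y => φ (z.1, y) := hφ.comp (by fun_prop)
  have h2 : ContDiff ℝ ∞ fun y => ψ (z.1, y) := hψ.comp (by fun_prop)
  have h3 : (2 : WithTop ℕ∞) ≤ ((⊤ : ℕ∞) : WithTop ℕ∞) := by norm_cast
  exact (h1.contDiffAt.of_le h3).laplacian_add (h2.contDiffAt.of_le h3)

theorem timeDeriv_smul (c : ℝ) (hφ : ContDiff ℝ ∞ φ) (z : ℝ × Euc d) :
    timeDeriv (c • φ) z = c * timeDeriv φ z := by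
  rw [timeDeriv_eq (show ContDiff ℝ ∞ (c • φ) from contDiff_const.smul hφ), timeDeriv_eq hφ,
    fderiv_const_smul (hφ.differentiable (by simp) z)]
  rfl

theorem gradient_const_smul {f : Euc d → ℝ} {x : Euc d} (c : ℝ) (hf : DifferentiableAt ℝ f x) :
    gradient (c • f) x = c • gradient f x := by
  rw [gradient, gradient, fderiv_const_smul hf, map_smulₛₗ]
  simp

theorem laplacian_const_smul {f : Euc d → ℝ} (c : ℝ) (hf : ContDiff ℝ ∞ f) (x : Euc d) :
    Laplacian.laplacian (c • f) x = c * Laplacian.laplacian f x :=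
  InnerProductSpace.laplacian_smul c (hf.contDiffAt.of_le (by norm_cast))

theorem spaceGrad_smul (c : ℝ) (hφ : ContDiff ℝ ∞ φ) (z : ℝ × Euc d) :
    spaceGrad (c • φ) z = c • spaceGrad φ z :=
  gradient_const_smul c ((hφ.comp (by fun_prop : ContDiff ℝ ∞ fun y => (z.1, y))).differentiable
    (by simp) _)

theorem spaceLap_smul (c : ℝ) (hφ : ContDiff ℝ ∞ φ) (z : ℝ × Euc d) :
    spaceLap (c • φ) z = c * spaceLap φ z :=
  laplacian_const_smul c (hφ.comp (by fun_prop : ContDiff ℝ ∞ fun y => (z.1, y))) _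

theorem timeDeriv_mul (η : ℝ → ℝ) (f : Euc d → ℝ) (z : ℝ × Euc d) :
    timeDeriv (fun z => η z.1 * f z.2) z = deriv η z.1 * f z.2 :=
  deriv_mul_const_field (f z.2)

theorem spaceGrad_mul (η : ℝ → ℝ) {f : Euc d → ℝ} (hf : ContDiff ℝ ∞ f) (z : ℝ × Euc d) :
    spaceGrad (fun z => η z.1 * f z.2) z = η z.1 • gradient f z.2 :=
  gradient_const_smul (η z.1) (hf.differentiable (by simp) _)

theorem spaceLap_mul (η : ℝ → ℝ) {f : Euc d → ℝ} (hf : ContDiff ℝ ∞ f) (z : ℝ × Euc d) :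
    spaceLap (fun z => η z.1 * f z.2) z = η z.1 * Laplacian.laplacian f z.2 :=
  laplacian_const_smul (η z.1) hf _

end Calculus

/-! ### Space-time measures and the weak formulation -/

theorem measurable_meas {d : ℕ} {μ : ℝ → P2 d} (hμ : Continuous fun s => (μ s).1) :
    Measurable fun s => (μ s).meas := by
  refine Measurable.measure_of_isPiSystem_of_isProbabilityMeasure
    (S := {F : Set (Euc d) | IsClosed F})
    (by rw [← borel_eq_generateFrom_isClosed]; exact BorelSpace.measurable_eq)
    isPiSystem_isClosed fun F hF => ?_
  refine measurable_of_tendsto_metrizable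
    (f := fun n s => ∫⁻ x, (hF.apprSeq n x : ℝ≥0∞) ∂(μ s).meas)
    (fun n => ?_) (tendsto_pi_nhds.2 fun s => HasOuterApproxClosed.tendsto_lintegral_apprSeq hF _)
  exact ((ProbabilityMeasure.continuous_lintegral_boundedContinuousFunction
    (hF.apprSeq n)).comp hμ).measurable

/-- A weakly continuous path of probability measures, as a kernel from time to space. -/
def pathKernel {d : ℕ} (μ : ℝ → P2 d) (hμ : Continuous fun s => (μ s).1) :
    ProbabilityTheory.Kernel ℝ (Euc d) where
  toFun s := (μ s).meas
  measurable' := measurable_meas hμ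

instance {d : ℕ} (μ : ℝ → P2 d) (hμ : Continuous fun s => (μ s).1) :
    ProbabilityTheory.IsMarkovKernel (pathKernel μ hμ) :=
  ⟨fun s => inferInstanceAs (IsProbabilityMeasure (μ s).meas)⟩

/-- The measure `μₛ(dx) ds` on `[t, T] × ℝᵈ`. -/
def spaceTime {d : ℕ} (t T : ℝ) (μ : ℝ → P2 d) (hμ : Continuous fun s => (μ s).1) :
    Measure (ℝ × Euc d) :=
  (volume.restrict (Icc t T)).compProd (pathKernel μ hμ)

section SpaceTime

variable {d : ℕ} {t T : ℝ} {μ : ℝ → P2 d} {hμ : Continuous fun s => (μ s).1}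

instance : IsFiniteMeasure (spaceTime t T μ hμ) := by
  unfold spaceTime; infer_instance

theorem lintegral_spaceTime {f : ℝ × Euc d → ℝ≥0∞} (hf : Measurable f) :
    ∫⁻ z, f z ∂spaceTime t T μ hμ = ∫⁻ s in Icc t T, ∫⁻ x, f (s, x) ∂(μ s).meas :=
  Measure.lintegral_compProd hf

theorem integral_spaceTime {f : ℝ × Euc d → ℝ} (hf : Integrable f (spaceTime t T μ hμ)) :
    ∫ z, f z ∂spaceTime t T μ hμ = ∫ s in Icc t T, ∫ x, f (s, x) ∂(μ s).meas :=
  Measure.integral_compProd hf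

theorem controlCost_eq {a : ℝ → Euc d → Euc d} (ha : Measurable fun p : ℝ × Euc d => a p.1 p.2) :
    controlCost t T μ a = 1 / 2 * ∫⁻ z, ‖a z.1 z.2‖ₑ ^ 2 ∂spaceTime t T μ hμ := by
  rw [controlCost, lintegral_spaceTime (ha.enorm.pow_const 2)]

theorem memLp_of_controlCost_lt_top {a : ℝ → Euc d → Euc d}
    (ha : Measurable fun p : ℝ × Euc d => a p.1 p.2) (hc : controlCost t T μ a < ⊤) :
    MemLp (fun z : ℝ × Euc d => a z.1 z.2) 2 (spaceTime t T μ hμ) := by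
  refine ⟨ha.aestronglyMeasurable, ?_⟩
  rw [controlCost_eq (hμ := hμ) ha] at hc
  rw [eLpNorm_lt_top_iff_lintegral_rpow_enorm_lt_top (by norm_num) (by norm_num)]
  have h := ENNReal.lt_top_of_mul_ne_top_right hc.ne (by simp)
  simpa using h

theorem DriftAssumption.continuous_comp {b : Euc d → P2 d → Euc d} (hb : DriftAssumption b)
    (hμ : Continuous fun s => (μ s).1) : Continuous fun z : ℝ × Euc d => b z.2 (μ z.1) :=
  continuous_iff_continuousAt.2 fun z =>
    hb.tendsto ((hμ.tendsto z.1).comp (continuous_fst.tendsto z)) (continuous_snd.tendsto z)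

/-- The part of the weak formulation which does not involve the control:
`∂ₛφ + ½ Δφ + b(·, μₛ) · ∇φ`. -/
def uncontrolledPart (b : Euc d → P2 d → Euc d) (μ : ℝ → P2 d) (φ : ℝ × Euc d → ℝ)
    (z : ℝ × Euc d) : ℝ :=
  timeDeriv φ z + 1 / 2 * spaceLap φ z + inner ℝ (b z.2 (μ z.1)) (spaceGrad φ z)

variable {b : Euc d → P2 d → Euc d} {φ : ℝ × Euc d → ℝ}

theorem integrable_uncontrolledPart (hb : DriftAssumption b) (hμ : Continuous fun s => (μ s).1)
    (hφ : ContDiff ℝ ∞ φ) (hc : HasCompactSupport φ) (Θ : Measure (ℝ × Euc d)) [IsFiniteMeasure Θ] :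
    Integrable (uncontrolledPart b μ φ) Θ := by
  refine Integrable.add (Integrable.add ?_ (Integrable.const_mul ?_ _)) ?_
  · exact (continuous_timeDeriv hφ).integrable_of_hasCompactSupport
      (hasCompactSupport_timeDeriv hφ hc)
  · exact (continuous_spaceLap hφ).integrable_of_hasCompactSupport
      (hasCompactSupport_spaceLap hφ hc)
  · refine ((hb.continuous_comp hμ).inner (continuous_spaceGrad hφ)).integrable_of_hasCompactSupport
      ((hasCompactSupport_spaceGrad hφ hc).mono fun z hz h => hz ?_)
    simp [h]

theorem memLp_spaceGrad (hφ : ContDiff ℝ ∞ φ) (hc : HasCompactSupport φ)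
    (Θ : Measure (ℝ × Euc d)) [IsFiniteMeasure Θ] : MemLp (spaceGrad φ) 2 Θ :=
  (continuous_spaceGrad hφ).memLp_of_hasCompactSupport (hasCompactSupport_spaceGrad hφ hc)

theorem integrable_inner_of_memLp {X E : Type*} [MeasurableSpace X] [NormedAddCommGroup E]
    [InnerProductSpace ℝ E] {m : Measure X} {f g : X → E} (hf : MemLp f 2 m) (hg : MemLp g 2 m) :
    Integrable (fun x => inner ℝ (f x) (g x)) m :=
  (L2.integrable_inner (𝕜 := ℝ) (hf.toLp f) (hg.toLp g)).congr (by
    filter_upwards [hf.coeFn_toLp, hg.coeFn_toLp] with x h1 h2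
    rw [h1, h2])

/-- The weak formulation in terms of the space-time measure. -/
theorem weakFormulation_eq {a : ℝ → Euc d → Euc d} (hb : DriftAssumption b)
    (ha : MemLp (fun z : ℝ × Euc d => a z.1 z.2) 2 (spaceTime t T μ hμ)) (hφ : ContDiff ℝ ∞ φ)
    (hc : HasCompactSupport φ) :
    ∫ s in Ioo t T, ∫ x,
      (deriv (fun r => φ (r, x)) s
        + 1 / 2 * Laplacian.laplacian (fun y => φ (s, y)) x
        + inner ℝ (b x (μ s) + a s x) (gradient (fun y => φ (s, y)) x)) ∂(μ s).meas
      = ∫ z, uncontrolledPart b μ φ z ∂spaceTime t T μ hμ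
        + ∫ z, inner ℝ (a z.1 z.2) (spaceGrad φ z) ∂spaceTime t T μ hμ := by
  have h1 := integrable_uncontrolledPart hb hμ hφ hc (spaceTime t T μ hμ)
  have h2 := integrable_inner_of_memLp ha (memLp_spaceGrad hφ hc (spaceTime t T μ hμ))
  rw [← integral_add h1 h2, integral_spaceTime (f := fun z => uncontrolledPart b μ φ z
    + inner ℝ (a z.1 z.2) (spaceGrad φ z)) (h1.add h2), Measure.restrict_congr_set Ioo_ae_eq_Icc]
  simp only [uncontrolledPart, timeDeriv, spaceLap, spaceGrad, inner_add_left, add_assoc]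

end SpaceTime

/-- Extending a path on `[t, T]` by its values at the end points does not affect admissibility. -/
theorem IsAdmissible.clamp {d : ℕ} {b : Euc d → P2 d → Euc d} {t T : ℝ} {ν : P2 d} {μ : ℝ → P2 d}
    {a : ℝ → Euc d → Euc d} (h : IsAdmissible b t T ν μ a) (htT : t ≤ T) :
    IsAdmissible b t T ν (fun s => μ (projIcc t T htT s)) a ∧
      controlCost t T (fun s => μ (projIcc t T htT s)) a = controlCost t T μ a ∧
      Continuous fun s => (μ (projIcc t T htT s)).1 := by
  have heq : ∀ s ∈ Icc t T, μ (projIcc t T htT s) = μ s := fun s hs => by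
    rw [projIcc_of_mem htT hs]
  have hcont : Continuous fun s => (μ (projIcc t T htT s)).1 :=
    (continuousOn_iff_continuous_domRestrict.1 h.continuousOn).comp continuous_projIcc
  refine ⟨⟨hcont.continuousOn, ?_, h.measurable, fun r => ?_, fun φ hφ => ?_⟩, ?_, hcont⟩
  · rw [heq t ⟨le_rfl, htT⟩, h.initial]
  · refine lt_of_eq_of_lt (setLIntegral_congr_fun measurableSet_Icc fun s hs => ?_)
      (h.locallyIntegrable r)
    simp only [heq s hs]
  · rw [← h.equation φ hφ]
    refine setIntegral_congr_fun measurableSet_Ioo fun s hs => ?_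
    simp only [heq s (Ioo_subset_Icc_self hs)]
  · rw [controlCost, controlCost]
    congr 1
    refine setLIntegral_congr_fun measurableSet_Icc fun s hs => ?_
    simp only [heq s hs]

/-! ### Time increments along solutions -/

/-- A smooth approximation of the indicator function of `[s, ∞)`. -/
def smoothStep (δ s u : ℝ) : ℝ := Real.smoothTransition ((u - s) / δ)

section SmoothStep

variable {δ s : ℝ}

theorem contDiff_smoothStep (δ s : ℝ) : ContDiff ℝ ∞ (smoothStep δ s) :=
  Real.smoothTransition.contDiff.comp (by fun_prop : ContDiff ℝ ∞ fun u : ℝ => (u - s) / δ)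

theorem monotone_smoothStep (hδ : 0 < δ) : Monotone (smoothStep δ s) := fun u v huv =>
  Real.smoothTransition.monotone (by gcongr)

theorem smoothStep_of_le (hδ : 0 < δ) {u : ℝ} (h : u ≤ s) : smoothStep δ s u = 0 :=
  Real.smoothTransition.zero_of_nonpos (div_nonpos_of_nonpos_of_nonneg (by linarith) hδ.le)

theorem smoothStep_of_ge (hδ : 0 < δ) {u : ℝ} (h : s + δ ≤ u) : smoothStep δ s u = 1 :=
  Real.smoothTransition.one_of_one_le ((one_le_div hδ).2 (by linarith))

theorem deriv_smoothStep_eq_zero (hδ : 0 < δ) {u : ℝ} (h : u ∉ Icc s (s + δ)) :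
    deriv (smoothStep δ s) u = 0 := by
  rw [mem_Icc, not_and_or, not_le, not_le] at h
  rcases h with h | h
  · have : smoothStep δ s =ᶠ[𝓝 u] fun _ => 0 := by
      filter_upwards [Iio_mem_nhds h] with v hv using smoothStep_of_le hδ (le_of_lt hv)
    rw [this.deriv_eq, deriv_const]
  · have : smoothStep δ s =ᶠ[𝓝 u] fun _ => 1 := by
      filter_upwards [Ioi_mem_nhds h] with v hv using smoothStep_of_ge hδ (le_of_lt hv)
    rw [this.deriv_eq, deriv_const]

/-- The derivative of the smooth step is an approximate Dirac mass. -/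
theorem abs_integral_deriv_smoothStep_sub_le {t T ε : ℝ} {f : ℝ → ℝ} (hf : Continuous f)
    (hδ : 0 < δ) (hts : t ≤ s) (hsT : s + δ ≤ T) (hε : ∀ u ∈ Icc s (s + δ), |f u - f s| ≤ ε) :
    |(∫ u in Icc t T, deriv (smoothStep δ s) u * f u) - f s| ≤ ε := by
  have htT : t ≤ T := by linarith
  have hc : Continuous (deriv (smoothStep δ s)) :=
    (contDiff_smoothStep δ s).continuous_deriv (by simp)
  have h1 : ∫ u in t..T, deriv (smoothStep δ s) u = 1 := by
    rw [intervalIntegral.integral_deriv_eq_sub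
      (fun x _ => (contDiff_smoothStep δ s).differentiable (by simp) x)
      (hc.intervalIntegrable _ _), smoothStep_of_ge hδ hsT, smoothStep_of_le hδ hts, sub_zero]
  have h2 : (∫ u in Icc t T, deriv (smoothStep δ s) u * f u) - f s
      = ∫ u in t..T, deriv (smoothStep δ s) u * (f u - f s) := by
    rw [integral_Icc_eq_integral_Ioc, ← intervalIntegral.integral_of_le htT]
    simp only [mul_sub]
    rw [intervalIntegral.integral_sub (f := fun u => deriv (smoothStep δ s) u * f u)
      (g := fun u => deriv (smoothStep δ s) u * f s) ((hc.mul hf).intervalIntegrable _ _)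
      ((hc.mul continuous_const).intervalIntegrable _ _), intervalIntegral.integral_mul_const, h1,
      one_mul]
  rw [h2, ← Real.norm_eq_abs]
  have h3 := intervalIntegral.norm_integral_le_of_norm_le (μ := volume)
    (f := fun u => deriv (smoothStep δ s) u * (f u - f s))
    (g := fun u => deriv (smoothStep δ s) u * ε) htT
    (ae_of_all _ fun u _ => by
      have h0 : 0 ≤ deriv (smoothStep δ s) u := (monotone_smoothStep hδ).deriv_nonneg
      rw [norm_mul, Real.norm_of_nonneg h0]
      by_cases hu : u ∈ Icc s (s + δ)
      · exact mul_le_mul_of_nonneg_left (hε u hu) h0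
      · rw [deriv_smoothStep_eq_zero hδ hu]; simp)
    ((hc.mul continuous_const).intervalIntegrable _ _)
  rwa [intervalIntegral.integral_mul_const, h1, one_mul] at h3

/-- An increment of `f` is controlled by a bound for `∫ η' f` over cutoff functions `η`. -/
theorem abs_sub_le_of_forall_integral_deriv {t T s r r' C : ℝ} {f : ℝ → ℝ} (hf : Continuous f)
    (hts : t < s) (hsr : s < r) (hrr : r < r') (hrT : r' < T)
    (hC : ∀ η : ℝ → ℝ, ContDiff ℝ ∞ η → (∀ u, 0 ≤ η u) → (∀ u, η u ≤ 1) →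
      tsupport η ⊆ Icc s r' → |∫ u in Icc t T, deriv η u * f u| ≤ C) : |f s - f r| ≤ C := by
  refine le_of_forall_pos_le_add fun ε hε => ?_
  have hcont : ∀ s₀, ∃ δ₀ > 0, ∀ u, |u - s₀| < δ₀ → |f u - f s₀| < ε / 2 := fun s₀ =>
    Metric.continuous_iff.1 hf s₀ (ε / 2) (by positivity)
  obtain ⟨δ₁, hδ₁, h1⟩ := hcont s
  obtain ⟨δ₂, hδ₂, h2⟩ := hcont r
  obtain ⟨δ, hδ, hδ'⟩ : ∃ δ, 0 < δ ∧ δ < min (min δ₁ δ₂) (r' - r) :=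
    exists_between (lt_min (lt_min hδ₁ hδ₂) (by linarith))
  rw [lt_min_iff, lt_min_iff] at hδ'
  set η : ℝ → ℝ := fun u => smoothStep δ s u - smoothStep δ r u with hη
  have hηs : ContDiff ℝ ∞ η := (contDiff_smoothStep δ s).sub (contDiff_smoothStep δ r)
  have hsupp : tsupport η ⊆ Icc s r' := by
    refine closure_minimal (fun u hu => ?_) isClosed_Icc
    by_contra hcon
    rw [mem_Icc, not_and_or, not_le, not_le] at hcon
    refine hu ?_
    rcases hcon with h | h
    · simp only [hη]
      rw [smoothStep_of_le hδ h.le, smoothStep_of_le hδ (by linarith), sub_zero]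
    · simp only [hη]
      rw [smoothStep_of_ge hδ (by linarith), smoothStep_of_ge hδ (by linarith), sub_self]
  have h3 := hC η hηs (fun u => by
      refine sub_nonneg.2 (Real.smoothTransition.monotone ?_)
      gcongr) (fun u => by
      have h4 : smoothStep δ s u ≤ 1 := Real.smoothTransition.le_one _
      have h5 : 0 ≤ smoothStep δ r u := Real.smoothTransition.nonneg _
      simp only [hη]; linarith) hsupp
  have h4 := abs_integral_deriv_smoothStep_sub_le (t := t) (T := T) (ε := ε / 2) hf hδ hts.le
    (by linarith) fun u hu => (h1 u (by
      rw [abs_of_nonneg (by linarith [hu.1])]; linarith [hu.2, hδ'.1.1])).le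
  have h5 := abs_integral_deriv_smoothStep_sub_le (s := r) (t := t) (T := T) (ε := ε / 2) hf hδ
    (by linarith) (by linarith) fun u hu => (h2 u (by
      rw [abs_of_nonneg (by linarith [hu.1])]; linarith [hu.2, hδ'.1.2])).le
  have hint : ∀ v, IntegrableOn (fun u => deriv (smoothStep δ v) u * f u) (Icc t T) := fun v =>
    (((contDiff_smoothStep δ v).continuous_deriv (by simp)).mul
      hf).continuousOn.integrableOn_compact isCompact_Icc
  have h6 : ∫ u in Icc t T, deriv η u * f u = (∫ u in Icc t T, deriv (smoothStep δ s) u * f u)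
      - ∫ u in Icc t T, deriv (smoothStep δ r) u * f u := by
    rw [← integral_sub (hint s) (hint r)]
    refine integral_congr_ae (ae_of_all _ fun u => ?_)
    have : deriv η u = deriv (smoothStep δ s) u - deriv (smoothStep δ r) u :=
      deriv_sub ((contDiff_smoothStep δ s).differentiable (by simp) u)
        ((contDiff_smoothStep δ r).differentiable (by simp) u)
    simp only [this, sub_mul]
  rw [h6] at h3
  rw [abs_le] at h3 h4 h5 ⊢
  constructor <;> linarith [h3.1, h3.2, h4.1, h4.2, h5.1, h5.2]

end SmoothStep

section Increments

variable {d : ℕ} {b : Euc d → P2 d → Euc d} {t T : ℝ} {ν : P2 d} {μ : ℝ → P2 d}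
  {a : ℝ → Euc d → Euc d} {hμ : Continuous fun s => (μ s).1} {B : ℝ} {ψ : Euc d → ℝ}

theorem isTestFunction_mul {η : ℝ → ℝ} (hη : ContDiff ℝ ∞ η) (hψ : ContDiff ℝ ∞ ψ)
    (hψc : HasCompactSupport ψ) {s r : ℝ} (hs : t < s) (hr : r < T) (hsupp : tsupport η ⊆ Icc s r) :
    IsTestFunction t T (fun z : ℝ × Euc d => η z.1 * ψ z.2) := by
  have hsub : tsupport (fun z : ℝ × Euc d => η z.1 * ψ z.2) ⊆ Icc s r ×ˢ tsupport ψ := by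
    refine closure_minimal (fun z hz => ?_) (isClosed_Icc.prod (isClosed_tsupport ψ))
    exact ⟨hsupp (subset_tsupport η (left_ne_zero_of_mul hz)),
      subset_tsupport ψ (right_ne_zero_of_mul hz)⟩
  refine ⟨(hη.comp contDiff_fst).mul (hψ.comp contDiff_snd),
    HasCompactSupport.of_support_subset_isCompact (isCompact_Icc.prod hψc)
      ((subset_tsupport _).trans hsub), fun z hz => ?_⟩
  have := (hsub hz).1
  exact ⟨⟨hs.trans_le this.1, this.2.trans_lt hr⟩, mem_univ _⟩

theorem continuous_gradient (hψ : ContDiff ℝ ∞ ψ) : Continuous (gradient ψ) :=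
  (InnerProductSpace.toDual ℝ (Euc d)).symm.continuous.comp (hψ.continuous_fderiv (by simp))

theorem norm_gradient (x : Euc d) : ‖gradient ψ x‖ = ‖fderiv ℝ ψ x‖ :=
  LinearIsometryEquiv.norm_map _ _

theorem continuous_laplacian (hψ : ContDiff ℝ ∞ ψ) : Continuous (Laplacian.laplacian ψ) := by
  rw [funext (laplacian_eq_sum_fderiv hψ)]
  exact continuous_finsetSum _ fun i _ =>
    (contDiff_fderiv_apply_const (contDiff_fderiv_apply_const hψ _) _).continuous

theorem hasCompactSupport_gradient (hψc : HasCompactSupport ψ) :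
    HasCompactSupport (gradient ψ) :=
  (hψc.fderiv ℝ).mono fun x hx h => hx (by simp [gradient, h])

theorem hasCompactSupport_laplacian (hψ : ContDiff ℝ ∞ ψ) (hψc : HasCompactSupport ψ) :
    HasCompactSupport (Laplacian.laplacian ψ) := by
  rw [funext (laplacian_eq_sum_fderiv hψ)]
  exact hasCompactSupport_sum fun i => (hψc.fderiv_apply ℝ _).fderiv_apply ℝ _

theorem spaceTime_Icc_prod_univ {s r : ℝ} (hs : t ≤ s) (hr : r ≤ T) :
    spaceTime t T μ hμ (Icc s r ×ˢ univ) = ENNReal.ofReal (r - s) := by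
  rw [spaceTime, Measure.compProd_apply_prod measurableSet_Icc MeasurableSet.univ]
  simp only [measure_univ, lintegral_const, one_mul, Measure.restrict_apply MeasurableSet.univ,
    univ_inter]
  rw [Measure.restrict_apply measurableSet_Icc,
    inter_eq_left.2 (Icc_subset_Icc hs hr), Real.volume_Icc]

/-- The space part of the integrand of the weak formulation, for a test function `η(s) ψ(x)` with
`0 ≤ η ≤ 1` and a drift bounded by `B`, is bounded by an integrable function. -/
theorem integrable_generatorBound
    (ha : MemLp (fun z : ℝ × Euc d => a z.1 z.2) 2 (spaceTime t T μ hμ)) (hψ : ContDiff ℝ ∞ ψ)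
    (hψc : HasCompactSupport ψ) :
    Integrable (fun z : ℝ × Euc d => 1 / 2 * |Laplacian.laplacian ψ z.2|
      + (B + ‖a z.1 z.2‖) * ‖gradient ψ z.2‖) (spaceTime t T μ hμ) := by
  obtain ⟨C₁, hC₁⟩ := (hasCompactSupport_laplacian hψ hψc).exists_bound_of_continuous
    (continuous_laplacian hψ)
  obtain ⟨C₂, hC₂⟩ := (hasCompactSupport_gradient hψc).exists_bound_of_continuous
    (continuous_gradient hψ)
  refine Integrable.add (Integrable.const_mul ?_ _) ?_
  · refine Integrable.of_bound
      ((continuous_laplacian hψ).comp continuous_snd).abs.aestronglyMeasurable C₁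
      (ae_of_all _ fun z => ?_)
    rw [Real.norm_eq_abs, abs_abs]
    exact hC₁ _
  · refine Integrable.mul_bdd (c := C₂) ?_
      ((continuous_gradient hψ).comp continuous_snd).norm.aestronglyMeasurable
      (ae_of_all _ fun z => ?_)
    · exact (integrable_const B).add (ha.integrable (by norm_num)).norm
    · rw [norm_norm]; exact hC₂ _

/-- The increments of `∫ ψ dμₛ` along a solution of the Fokker–Planck equation. The test functions
approximating the indicator function of `[s, r]` are supported in the larger interval `[s, r']`. -/
theorem IsAdmissible.abs_integral_sub_le (h : IsAdmissible b t T ν μ a) (hb : DriftAssumption b)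
    (hB : ∀ x m, ‖b x m‖ ≤ B)
    (ha : MemLp (fun z : ℝ × Euc d => a z.1 z.2) 2 (spaceTime t T μ hμ)) (hψ : ContDiff ℝ ∞ ψ)
    (hψc : HasCompactSupport ψ) {s r r' : ℝ} (hs : t < s) (hsr : s < r) (hrr : r < r')
    (hr' : r' < T) :
    |∫ x, ψ x ∂(μ s).meas - ∫ x, ψ x ∂(μ r).meas| ≤
      ∫ z in Icc s r' ×ˢ univ, (1 / 2 * |Laplacian.laplacian ψ z.2|
        + (B + ‖a z.1 z.2‖) * ‖gradient ψ z.2‖) ∂spaceTime t T μ hμ := by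
  have hf : Continuous fun s => ∫ x, ψ x ∂(μ s).meas :=
    (continuous_integral_of_hasCompactSupport hψ.continuous hψc).comp hμ
  refine abs_sub_le_of_forall_integral_deriv hf hs hsr hrr hr' fun η hη hη0 hη1 hηs => ?_
  set φ : ℝ × Euc d → ℝ := fun z => η z.1 * ψ z.2 with hφ
  have htest : IsTestFunction t T φ := isTestFunction_mul hη hψ hψc hs hr' hηs
  have heq := h.equation φ htest
  rw [weakFormulation_eq (hμ := hμ) hb ha htest.1 htest.2.1] at heq
  have hi1 : Integrable (timeDeriv φ) (spaceTime t T μ hμ) :=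
    (continuous_timeDeriv htest.1).integrable_of_hasCompactSupport
      (hasCompactSupport_timeDeriv htest.1 htest.2.1)
  have hi2 := integrable_uncontrolledPart hb hμ htest.1 htest.2.1 (spaceTime t T μ hμ)
  have hi3 := integrable_inner_of_memLp ha (memLp_spaceGrad htest.1 htest.2.1 (spaceTime t T μ hμ))
  have htime : ∫ u in Icc t T, deriv η u * ∫ x, ψ x ∂(μ u).meas
      = ∫ z, timeDeriv φ z ∂spaceTime t T μ hμ := by
    rw [integral_spaceTime hi1]
    refine integral_congr_ae (ae_of_all _ fun u => ?_)
    simp only [hφ, timeDeriv_mul]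
    exact (integral_const_mul _ _).symm
  have hrest : ∫ z, timeDeriv φ z ∂spaceTime t T μ hμ
      = ∫ z, (timeDeriv φ z - uncontrolledPart b μ φ z - inner ℝ (a z.1 z.2) (spaceGrad φ z))
        ∂spaceTime t T μ hμ := by
    rw [integral_sub (f := fun z => timeDeriv φ z - uncontrolledPart b μ φ z)
      (hi1.sub hi2) hi3, integral_sub hi1 hi2]
    linarith
  rw [htime, hrest, ← integral_indicator (measurableSet_Icc.prod MeasurableSet.univ),
    ← Real.norm_eq_abs]
  refine norm_integral_le_of_norm_le ((integrable_generatorBound ha hψ hψc).indicator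
    (measurableSet_Icc.prod MeasurableSet.univ)) (ae_of_all _ fun z => ?_)
  have h1 : timeDeriv φ z - uncontrolledPart b μ φ z - inner ℝ (a z.1 z.2) (spaceGrad φ z)
      = -(η z.1 * (1 / 2 * Laplacian.laplacian ψ z.2
        + inner ℝ (b z.2 (μ z.1) + a z.1 z.2) (gradient ψ z.2))) := by
    rw [uncontrolledPart, hφ, spaceLap_mul η hψ, spaceGrad_mul η hψ]
    simp only [inner_smul_right, inner_add_left]
    ring
  rw [h1, norm_neg, norm_mul]
  by_cases hz : z ∈ Icc s r' ×ˢ (univ : Set (Euc d))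
  · rw [indicator_of_mem hz]
    have h2 : ‖inner ℝ (b z.2 (μ z.1) + a z.1 z.2) (gradient ψ z.2)‖
        ≤ (B + ‖a z.1 z.2‖) * ‖gradient ψ z.2‖ := by
      refine (norm_inner_le_norm _ _).trans (mul_le_mul_of_nonneg_right ?_ (norm_nonneg _))
      exact (norm_add_le _ _).trans (add_le_add_left (hB _ _) _)
    have h3 : ‖1 / 2 * Laplacian.laplacian ψ z.2‖ = 1 / 2 * |Laplacian.laplacian ψ z.2| := by
      rw [norm_mul, Real.norm_eq_abs, Real.norm_eq_abs]; norm_num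
    have h4 : ‖η z.1‖ ≤ 1 := by rw [Real.norm_of_nonneg (hη0 _)]; exact hη1 _
    calc ‖η z.1‖ * ‖1 / 2 * Laplacian.laplacian ψ z.2
          + inner ℝ (b z.2 (μ z.1) + a z.1 z.2) (gradient ψ z.2)‖
        ≤ 1 * (1 / 2 * |Laplacian.laplacian ψ z.2| + (B + ‖a z.1 z.2‖) * ‖gradient ψ z.2‖) := by
          refine mul_le_mul h4 ?_ (norm_nonneg _) zero_le_one
          exact (norm_add_le _ _).trans (add_le_add h3.le h2)
      _ = _ := one_mul _
  · rw [indicator_of_notMem hz]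
    have : η z.1 = 0 := by
      by_contra h0
      exact hz ⟨hηs (subset_tsupport η h0), mem_univ _⟩
    rw [this]; simp

/-- A bound for the increments of a continuous function on `[t, T]` can be checked at interior times
in increasing order. -/
theorem abs_sub_le_of_interior {f : ℝ → ℝ} (hf : Continuous f) {A K : ℝ} (hK : 0 ≤ K)
    (h : ∀ s r, t < s → s < r → r < T → |f s - f r| ≤ A * |s - r| + K) {s r : ℝ}
    (hs : s ∈ Icc t T) (hr : r ∈ Icc t T) : |f s - f r| ≤ A * |s - r| + K := by
  have hint : ∀ s ∈ Ioo t T, ∀ r ∈ Ioo t T, |f s - f r| ≤ A * |s - r| + K := by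
    intro s hs r hr
    rcases lt_trichotomy s r with hsr | rfl | hsr
    · exact h s r hs.1 hsr hr.2
    · simpa using hK
    · rw [abs_sub_comm, abs_sub_comm s r]
      exact h r s hr.1 hsr hs.2
  have hclosed : IsClosed {p : ℝ × ℝ | |f p.1 - f p.2| ≤ A * |p.1 - p.2| + K} :=
    isClosed_le ((hf.comp continuous_fst).sub (hf.comp continuous_snd)).abs (by fun_prop)
  rcases (hs.1.trans hs.2).eq_or_lt with htT | htT
  · have h1 : s = r := by
      subst htT
      rw [Icc_self, mem_singleton_iff] at hs hr
      rw [hs, hr]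
    simpa [h1] using hK
  · have hsub : closure (Ioo t T ×ˢ Ioo t T) ⊆
        {p : ℝ × ℝ | |f p.1 - f p.2| ≤ A * |p.1 - p.2| + K} :=
      closure_minimal (fun p hp => hint _ hp.1 _ hp.2) hclosed
    rw [closure_prod_eq, closure_Ioo htT.ne] at hsub
    exact hsub (mk_mem_prod hs hr)

/-- Young's inequality with a parameter. -/
theorem mul_le_add_sq {x y lam : ℝ} (hlam : 0 < lam) :
    x * y ≤ lam / 2 * x ^ 2 + 1 / (2 * lam) * y ^ 2 := by
  have h : lam / 2 * x ^ 2 + 1 / (2 * lam) * y ^ 2 - x * y = (lam * x - y) ^ 2 / (2 * lam) := by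
    field_simp; ring
  have : 0 ≤ (lam * x - y) ^ 2 / (2 * lam) := by positivity
  linarith

theorem integrable_norm_sq
    (ha : MemLp (fun z : ℝ × Euc d => a z.1 z.2) 2 (spaceTime t T μ hμ)) :
    Integrable (fun z : ℝ × Euc d => ‖a z.1 z.2‖ ^ 2) (spaceTime t T μ hμ) :=
  ha.integrable_norm_pow (by norm_num)

/-- A bound for the time increments of `∫ ψ dμₛ` which, given `ψ` and a bound `B` for the drift,
only depends on the cost of the control. The free parameter `lam` is that of Young's inequality. -/
theorem IsAdmissible.abs_integral_sub_le_mul (h : IsAdmissible b t T ν μ a) (hb : DriftAssumption b)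
    (hB0 : 0 ≤ B) (hB : ∀ x m, ‖b x m‖ ≤ B)
    (ha : MemLp (fun z : ℝ × Euc d => a z.1 z.2) 2 (spaceTime t T μ hμ)) (hψ : ContDiff ℝ ∞ ψ)
    (hψc : HasCompactSupport ψ) {C c lam : ℝ} (hC1 : ∀ x, |Laplacian.laplacian ψ x| ≤ C)
    (hC2 : ∀ x, ‖gradient ψ x‖ ≤ C)
    (hc : ∫ z, ‖a z.1 z.2‖ ^ 2 ∂spaceTime t T μ hμ ≤ c) (hlam : 0 < lam) {s r : ℝ}
    (hs : s ∈ Icc t T) (hr : r ∈ Icc t T) :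
    |∫ x, ψ x ∂(μ s).meas - ∫ x, ψ x ∂(μ r).meas| ≤
      C * (1 / 2 + B + 1 / (2 * lam)) * |s - r| + C * (lam / 2) * c := by
  have hC0 : 0 ≤ C := (abs_nonneg _).trans (hC1 0)
  have hf : Continuous fun s => ∫ x, ψ x ∂(μ s).meas :=
    (continuous_integral_of_hasCompactSupport hψ.continuous hψc).comp hμ
  have hc0 : 0 ≤ c := le_trans (integral_nonneg fun z => by positivity) hc
  set A := C * (1 / 2 + B + 1 / (2 * lam)) with hA
  have hint' : ∀ s r, t < s → s < r → r < T →
      |∫ x, ψ x ∂(μ s).meas - ∫ x, ψ x ∂(μ r).meas| ≤ A * (r - s) + C * (lam / 2) * c := by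
    intro s r hs hsr hr
    have hbd : ∀ r' ∈ Ioo r T, |∫ x, ψ x ∂(μ s).meas - ∫ x, ψ x ∂(μ r).meas|
        ≤ A * (r' - s) + C * (lam / 2) * c := by
      intro r' hr'
      refine (h.abs_integral_sub_le hb hB ha hψ hψc hs hsr hr'.1 hr'.2).trans ?_
      have hi := integrable_norm_sq ha
      have hpt : ∀ z : ℝ × Euc d, 1 / 2 * |Laplacian.laplacian ψ z.2|
          + (B + ‖a z.1 z.2‖) * ‖gradient ψ z.2‖ ≤ A + C * (lam / 2) * ‖a z.1 z.2‖ ^ 2 := by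
        intro z
        have h1 := mul_le_add_sq (x := ‖a z.1 z.2‖) (y := 1) hlam
        have h2 : (B + ‖a z.1 z.2‖) * ‖gradient ψ z.2‖ ≤ (B + ‖a z.1 z.2‖) * C :=
          mul_le_mul_of_nonneg_left (hC2 _) (by positivity)
        have h3 : C * ‖a z.1 z.2‖ ≤ C * (lam / 2 * ‖a z.1 z.2‖ ^ 2 + 1 / (2 * lam)) :=
          mul_le_mul_of_nonneg_left (by linarith) hC0
        rw [hA]
        nlinarith [hC1 z.2]
      calc ∫ z in Icc s r' ×ˢ univ, (1 / 2 * |Laplacian.laplacian ψ z.2|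
            + (B + ‖a z.1 z.2‖) * ‖gradient ψ z.2‖) ∂spaceTime t T μ hμ
          ≤ ∫ z in Icc s r' ×ˢ univ, (A + C * (lam / 2) * ‖a z.1 z.2‖ ^ 2)
            ∂spaceTime t T μ hμ :=
            setIntegral_mono (integrable_generatorBound ha hψ hψc).integrableOn
              ((integrable_const A).add (hi.const_mul _)).integrableOn hpt
        _ = A * (r' - s) + C * (lam / 2) * ∫ z in Icc s r' ×ˢ univ, ‖a z.1 z.2‖ ^ 2
            ∂spaceTime t T μ hμ := by
            have hmul : ∫ z in Icc s r' ×ˢ univ, C * (lam / 2) * ‖a z.1 z.2‖ ^ 2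
                ∂spaceTime t T μ hμ = C * (lam / 2) * ∫ z in Icc s r' ×ˢ univ, ‖a z.1 z.2‖ ^ 2
                ∂spaceTime t T μ hμ := integral_const_mul _ _
            rw [integral_add (integrable_const A) (hi.const_mul _).integrableOn,
              hmul, setIntegral_const, measureReal_def,
              spaceTime_Icc_prod_univ hs.le hr'.2.le,
              ENNReal.toReal_ofReal (by linarith [hr'.1]), smul_eq_mul]
            ring
        _ ≤ A * (r' - s) + C * (lam / 2) * c := by
            have := setIntegral_le_integral (s := Icc s r' ×ˢ univ) hi
              (ae_of_all _ fun z => by positivity)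
            gcongr
            exact this.trans hc
    have hlim : Tendsto (fun r' => A * (r' - s) + C * (lam / 2) * c) (𝓝[>] r)
        (𝓝 (A * (r - s) + C * (lam / 2) * c)) :=
      ((by fun_prop : Continuous fun r' => A * (r' - s) + C * (lam / 2) * c).tendsto r).mono_left
        nhdsWithin_le_nhds
    exact ge_of_tendsto hlim (by filter_upwards [Ioo_mem_nhdsGT hr] with r' hr' using hbd r' hr')
  refine abs_sub_le_of_interior hf (by positivity) (fun s r hs hsr hr => ?_) hs hr
  rw [abs_sub_comm s r, abs_of_pos (sub_pos.2 hsr)]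
  exact hint' s r hs hsr hr

end Increments

/-! ### Uniform second moments -/

/-- A smooth substitute for `min(|x|², 4)`, up to an additive constant compactly supported, whose
squared gradient is controlled by the function itself. -/
theorem exists_contDiff_truncatedSq (d : ℕ) : ∃ L : ℝ, 0 < L ∧ ∃ φ : Euc d → ℝ, ContDiff ℝ ∞ φ ∧
    HasCompactSupport φ ∧ (∀ x, min (‖x‖ ^ 2) 4 ≤ φ x + 4) ∧ (∀ x, φ x + 4 ≤ 4 * ‖x‖ ^ 2) ∧
    (∀ x, ‖gradient φ x‖ ^ 2 ≤ L * (φ x + 4)) ∧ ∀ x, |Laplacian.laplacian φ x| ≤ L := by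
  let χ : ContDiffBump (0 : Euc d) := ⟨1, 2, zero_lt_one, one_lt_two⟩
  set φ : Euc d → ℝ := fun x => χ x * (‖x‖ ^ 2 - 4) with hφdef
  have hφ : ContDiff ℝ ∞ φ := χ.contDiff.mul ((contDiff_norm_sq ℝ).sub contDiff_const)
  have hφc : HasCompactSupport φ := χ.hasCompactSupport.mul_right
  have hχ1 : ∀ x : Euc d, ‖x‖ ≤ 1 → χ x = 1 := fun x hx =>
    χ.one_of_mem_closedBall (mem_closedBall_zero_iff.2 hx)
  have hlow : ∀ x, min (‖x‖ ^ 2) 4 ≤ φ x + 4 := fun x => by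
    have h0 : 0 ≤ χ x := χ.nonneg
    have h1 : χ x ≤ 1 := χ.le_one
    have h2 := min_le_left (‖x‖ ^ 2) (4 : ℝ)
    have h3 := min_le_right (‖x‖ ^ 2) (4 : ℝ)
    simp only [hφdef]
    nlinarith
  have hup : ∀ x, φ x + 4 ≤ 4 * ‖x‖ ^ 2 := fun x => by
    simp only [hφdef]
    rcases le_total ‖x‖ 1 with hx | hx
    · rw [hχ1 x hx]; nlinarith [sq_nonneg ‖x‖]
    · have h0 : 0 ≤ χ x := χ.nonneg
      have h1 : χ x ≤ 1 := χ.le_one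
      have h2 : 1 ≤ ‖x‖ ^ 2 := one_le_pow₀ hx
      nlinarith
  obtain ⟨C₁, hC₁⟩ := (hasCompactSupport_laplacian hφ hφc).exists_bound_of_continuous
    (continuous_laplacian hφ)
  obtain ⟨C₂, hC₂⟩ := (hasCompactSupport_gradient hφc).exists_bound_of_continuous
    (continuous_gradient hφ)
  have hC₁0 : 0 ≤ C₁ := (norm_nonneg _).trans (hC₁ 0)
  have hnonneg : ∀ x, 0 ≤ φ x + 4 := fun x =>
    le_trans (le_min (by positivity) (by norm_num)) (hlow x)
  refine ⟨4 + C₂ ^ 2 + C₁, by positivity, φ, hφ, hφc, hlow, hup, fun x => ?_, fun x => ?_⟩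
  · rcases lt_or_ge ‖x‖ 1 with hx | hx
    · have heq : φ =ᶠ[𝓝 x] fun y => ‖y‖ ^ 2 - 4 := by
        filter_upwards [Metric.isOpen_ball.mem_nhds (mem_ball_zero_iff.2 hx)] with y hy
        simp only [hφdef]
        rw [hχ1 y (mem_ball_zero_iff.1 hy).le, one_mul]
      have hgrad : ‖gradient φ x‖ = 2 * ‖x‖ := by
        rw [norm_gradient, heq.fderiv_eq, fderiv_sub_const, fderiv_norm_sq_apply,
          ← Nat.cast_smul_eq_nsmul ℝ, norm_smul, innerSL_apply_norm]
        norm_num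
      have h1 : φ x + 4 = ‖x‖ ^ 2 := by rw [heq.eq_of_nhds]; ring
      rw [hgrad, h1]
      nlinarith [sq_nonneg ‖x‖, mul_nonneg (sq_nonneg C₂) (sq_nonneg ‖x‖),
        mul_nonneg hC₁0 (sq_nonneg ‖x‖)]
    · have h1 : 1 ≤ φ x + 4 :=
        le_trans (le_min (one_le_pow₀ hx) (by norm_num)) (hlow x)
      have h2 : ‖gradient φ x‖ ^ 2 ≤ C₂ ^ 2 := pow_le_pow_left₀ (norm_nonneg _) (hC₂ x) 2
      nlinarith [sq_nonneg C₂]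
  · have := hC₁ x
    rw [Real.norm_eq_abs] at this
    nlinarith [sq_nonneg C₂]

/-- Rescaling preserves the constant in the bounds for the truncated square. -/
theorem exists_contDiff_truncatedSq_scaled (d : ℕ) : ∃ L : ℝ, 0 < L ∧ ∀ k : ℝ, 0 < k →
    ∃ φ : Euc d → ℝ, ContDiff ℝ ∞ φ ∧ HasCompactSupport φ ∧
      (∀ x, min (‖x‖ ^ 2) (4 * k ^ 2) ≤ φ x + 4 * k ^ 2) ∧
      (∀ x, φ x + 4 * k ^ 2 ≤ 4 * ‖x‖ ^ 2) ∧
      (∀ x, ‖gradient φ x‖ ^ 2 ≤ L * (φ x + 4 * k ^ 2)) ∧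
      ∀ x, |Laplacian.laplacian φ x| ≤ L := by
  obtain ⟨L, hL, φ, hφ, hφc, h1, h2, h3, h4⟩ := exists_contDiff_truncatedSq d
  refine ⟨L, hL, fun k hk => ?_⟩
  have hk0 : k ≠ 0 := hk.ne'
  set φk : Euc d → ℝ := fun x => k ^ 2 * φ (k⁻¹ • x) with hφk
  have hφks : ContDiff ℝ ∞ φk := contDiff_const.mul (hφ.comp (contDiff_const_smul _))
  have hφkc : HasCompactSupport φk := (hφc.comp_smul (inv_ne_zero hk0)).mul_left
  have hnorm : ∀ x : Euc d, ‖k⁻¹ • x‖ ^ 2 = (k ^ 2)⁻¹ * ‖x‖ ^ 2 := fun x => by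
    rw [norm_smul, mul_pow, norm_inv, Real.norm_of_nonneg hk.le, inv_pow]
  have hfd : ∀ x, fderiv ℝ φk x = k • fderiv ℝ φ (k⁻¹ • x) := fun x => by
    have hd : DifferentiableAt ℝ (fun x => φ (k⁻¹ • x)) x :=
      ((hφ.comp (contDiff_const_smul k⁻¹)).differentiable (by simp) x)
    rw [hφk, fderiv_const_mul hd, fderiv_comp_smul, smul_smul]
    congr 1
    field_simp
  refine ⟨φk, hφks, hφkc, fun x => ?_, fun x => ?_, fun x => ?_, fun x => ?_⟩
  · have h5 := mul_le_mul_of_nonneg_left (h1 (k⁻¹ • x)) (sq_nonneg k)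
    rw [mul_min_of_nonneg _ _ (sq_nonneg k), hnorm, ← mul_assoc,
      mul_inv_cancel₀ (pow_ne_zero 2 hk0), one_mul] at h5
    simp only [hφk]
    rw [mul_comm 4 (k ^ 2)]
    linarith
  · have h5 := mul_le_mul_of_nonneg_left (h2 (k⁻¹ • x)) (sq_nonneg k)
    rw [hnorm] at h5
    have h6 : k ^ 2 * (4 * ((k ^ 2)⁻¹ * ‖x‖ ^ 2)) = 4 * ‖x‖ ^ 2 := by field_simp
    simp only [hφk]
    linarith
  · have h5 := mul_le_mul_of_nonneg_left (h3 (k⁻¹ • x)) (sq_nonneg k)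
    rw [norm_gradient] at h5 ⊢
    rw [hfd, norm_smul, mul_pow, Real.norm_of_nonneg hk.le]
    simp only [hφk]
    linarith
  · refine le_trans (le_of_eq ?_) (h4 (k⁻¹ • x))
    congr 1
    rw [laplacian_eq_sum_fderiv hφks, laplacian_eq_sum_fderiv hφ]
    refine Finset.sum_congr rfl fun i _ => ?_
    simp only [hfd, smul_apply, smul_eq_mul]
    set e := EuclideanSpace.basisFun (Fin d) ℝ i
    have hd : DifferentiableAt ℝ (fun y => fderiv ℝ φ (k⁻¹ • y) e) x :=
      ((contDiff_fderiv_apply_const hφ e).comp (contDiff_const_smul k⁻¹)).differentiable (by simp) x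
    have h5 := fderiv_comp_smul (𝕜 := ℝ) (f := fun y => fderiv ℝ φ y e) (x := x) k⁻¹
    rw [fderiv_const_mul hd, h5, smul_smul, mul_inv_cancel₀ hk0, one_smul]

section Moments

variable {d : ℕ} {b : Euc d → P2 d → Euc d} {t T : ℝ} {ν : P2 d} {μ : ℝ → P2 d}
  {a : ℝ → Euc d → Euc d} {hμ : Continuous fun s => (μ s).1} {B : ℝ} {ψ : Euc d → ℝ}

/-- If `|∇ψ|² ≤ L (ψ + κ)`, then the drift and control terms in the evolution of `∫ (ψ + κ) dμₛ` can
be absorbed into its maximum over `[t, T]`, up to the cost of the control. -/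
theorem IsAdmissible.integral_add_const_le (h : IsAdmissible b t T ν μ a) (hb : DriftAssumption b)
    (hB0 : 0 ≤ B) (hB : ∀ x m, ‖b x m‖ ≤ B) (htT : t < T)
    (ha : MemLp (fun z : ℝ × Euc d => a z.1 z.2) 2 (spaceTime t T μ hμ)) (hψ : ContDiff ℝ ∞ ψ)
    (hψc : HasCompactSupport ψ) {L κ c : ℝ} (hL : 0 < L) (hpos : ∀ x, 0 ≤ ψ x + κ)
    (hgrad : ∀ x, ‖gradient ψ x‖ ^ 2 ≤ L * (ψ x + κ))
    (hlap : ∀ x, |Laplacian.laplacian ψ x| ≤ L)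
    (hc : ∫ z, ‖a z.1 z.2‖ ^ 2 ∂spaceTime t T μ hμ ≤ c) {r : ℝ} (hr : r ∈ Icc t T) :
    ∫ x, (ψ x + κ) ∂(μ r).meas ≤ 2 * (∫ x, (ψ x + κ) ∂ν.meas
      + ((L / 2 + L * (T - t) * B ^ 2) * (T - t) + L * (T - t) * c)) := by
  have htT' : 0 < T - t := sub_pos.2 htT
  have hψi : ∀ m : P2 d, Integrable ψ m.meas := fun m =>
    hψ.continuous.integrable_of_hasCompactSupport hψc
  set f : ℝ → ℝ := fun s => ∫ x, (ψ x + κ) ∂(μ s).meas with hfdef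
  have hfeq : ∀ s, f s = ∫ x, ψ x ∂(μ s).meas + κ := fun s => by
    simp only [hfdef]
    rw [integral_add (hψi _) (integrable_const _)]
    simp
  have hf : Continuous f := by
    rw [funext hfeq]
    exact ((continuous_integral_of_hasCompactSupport hψ.continuous hψc).comp hμ).add
      continuous_const
  have hc0 : 0 ≤ c := le_trans (integral_nonneg fun z => by positivity) hc
  obtain ⟨u, hu, hmax⟩ := isCompact_Icc.exists_isMaxOn (nonempty_Icc.2 htT.le) hf.continuousOn
  set m := f u with hm
  have hm0 : 0 ≤ m := integral_nonneg hpos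
  set K := (L / 2 + L * (T - t) * B ^ 2) * (T - t) + L * (T - t) * c with hK
  have hK0 : 0 ≤ K := by positivity
  have hi := integrable_norm_sq ha
  have hψΘ : Integrable (fun z : ℝ × Euc d => ψ z.2 + κ) (spaceTime t T μ hμ) := by
    obtain ⟨C, hC⟩ := hψc.exists_bound_of_continuous hψ.continuous
    exact (Integrable.of_bound (hψ.continuous.comp continuous_snd).aestronglyMeasurable C
      (ae_of_all _ fun z => hC _)).add (integrable_const _)
  have hψint : ∫ z, (ψ z.2 + κ) ∂spaceTime t T μ hμ ≤ (T - t) * m := by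
    rw [integral_spaceTime hψΘ]
    calc ∫ s in Icc t T, f s ≤ ∫ _ in Icc t T, m :=
          setIntegral_mono_on (hf.continuousOn.integrableOn_compact isCompact_Icc)
            (integrableOn_const (by simp)) measurableSet_Icc fun s hs => hmax hs
      _ = (T - t) * m := by
          rw [setIntegral_const, measureReal_def, Real.volume_Icc, ENNReal.toReal_ofReal htT'.le,
            smul_eq_mul]
  have hinc : ∀ s r, t < s → s < r → r < T → |f s - f r| ≤ 0 * |s - r| + (K + m / 2) := by
    intro s r hs hsr hr
    obtain ⟨r', hr'⟩ := exists_between hr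
    have h1 : f s - f r = ∫ x, ψ x ∂(μ s).meas - ∫ x, ψ x ∂(μ r).meas := by
      rw [hfeq, hfeq]; ring
    rw [h1, zero_mul, zero_add]
    refine (h.abs_integral_sub_le hb hB ha hψ hψc hs hsr hr'.1 hr'.2).trans ?_
    -- Young's inequality with the parameter for which half of the maximum is absorbed
    set lam := L * (T - t) with hlam
    have hlam0 : 0 < lam := by positivity
    have hpt : ∀ z : ℝ × Euc d, 1 / 2 * |Laplacian.laplacian ψ z.2|
        + (B + ‖a z.1 z.2‖) * ‖gradient ψ z.2‖
        ≤ (L / 2 + lam * B ^ 2) + lam * ‖a z.1 z.2‖ ^ 2 + L / (2 * lam) * (ψ z.2 + κ) := by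
      intro z
      have h2 := mul_le_add_sq (x := B + ‖a z.1 z.2‖) (y := ‖gradient ψ z.2‖) hlam0
      have h3 : 1 / (2 * lam) * ‖gradient ψ z.2‖ ^ 2 ≤ 1 / (2 * lam) * (L * (ψ z.2 + κ)) :=
        mul_le_mul_of_nonneg_left (hgrad _) (by positivity)
      have h4 : lam / 2 * (B + ‖a z.1 z.2‖) ^ 2 ≤ lam * B ^ 2 + lam * ‖a z.1 z.2‖ ^ 2 := by
        nlinarith [mul_nonneg hlam0.le (sq_nonneg (B - ‖a z.1 z.2‖))]
      have h5 : 1 / (2 * lam) * (L * (ψ z.2 + κ)) = L / (2 * lam) * (ψ z.2 + κ) := by ring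
      linarith [hlap z.2]
    have hH1 : Integrable (fun z : ℝ × Euc d => (L / 2 + lam * B ^ 2) + lam * ‖a z.1 z.2‖ ^ 2)
      (spaceTime t T μ hμ) := (integrable_const _).add (hi.const_mul _)
    have hH2 : Integrable (fun z : ℝ × Euc d => L / (2 * lam) * (ψ z.2 + κ))
      (spaceTime t T μ hμ) := hψΘ.const_mul _
    have hvol : (spaceTime t T μ hμ).real univ = T - t := by
      rw [measureReal_def, spaceTime, Measure.compProd_apply_univ]
      simp [htT.le]
    calc ∫ z in Icc s r' ×ˢ univ, (1 / 2 * |Laplacian.laplacian ψ z.2|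
          + (B + ‖a z.1 z.2‖) * ‖gradient ψ z.2‖) ∂spaceTime t T μ hμ
        ≤ ∫ z, (1 / 2 * |Laplacian.laplacian ψ z.2|
          + (B + ‖a z.1 z.2‖) * ‖gradient ψ z.2‖) ∂spaceTime t T μ hμ :=
          setIntegral_le_integral (integrable_generatorBound ha hψ hψc)
            (ae_of_all _ fun z => by positivity)
      _ ≤ ∫ z, ((L / 2 + lam * B ^ 2) + lam * ‖a z.1 z.2‖ ^ 2 + L / (2 * lam) * (ψ z.2 + κ))
          ∂spaceTime t T μ hμ :=
          integral_mono (integrable_generatorBound ha hψ hψc) (hH1.add hH2) hpt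
      _ = (L / 2 + lam * B ^ 2) * (T - t) + lam * ∫ z, ‖a z.1 z.2‖ ^ 2 ∂spaceTime t T μ hμ
          + L / (2 * lam) * ∫ z, (ψ z.2 + κ) ∂spaceTime t T μ hμ := by
          rw [integral_add hH1 hH2, integral_add (integrable_const _) (hi.const_mul _),
            integral_const, hvol, smul_eq_mul, integral_const_mul, integral_const_mul]
          ring
      _ ≤ (L / 2 + lam * B ^ 2) * (T - t) + lam * c + L / (2 * lam) * ((T - t) * m) := by
          gcongr
      _ = K + m / 2 := by
          rw [hK, hlam]; field_simp
  have hinc' := abs_sub_le_of_interior hf (by positivity) hinc ⟨le_rfl, htT.le⟩ hu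
  rw [zero_mul, zero_add, abs_le] at hinc'
  have h2 : m ≤ 2 * (f t + K) := by linarith [hinc'.1]
  have h3 : f t = ∫ x, (ψ x + κ) ∂ν.meas := by simp only [hfdef, h.initial]
  rw [← h3]
  exact (hmax hr).trans h2

theorem P2.integrable_norm_sq (m : P2 d) : Integrable (fun x => ‖x‖ ^ 2) m.meas := by
  refine ⟨by fun_prop, ?_⟩
  have h : ∫⁻ x, ‖x‖ₑ ^ 2 ∂m.meas < ⊤ := m.2
  simpa [HasFiniteIntegral, enorm_pow] using h

/-- The second moments along solutions of the Fokker–Planck equation are bounded in terms of the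
initial second moment and the cost of the control. -/
theorem exists_secondMoment_bound (hb : DriftAssumption b) (htT : t < T) (ν : P2 d) (c : ℝ) :
    ∃ M : ℝ≥0∞, M ≠ ⊤ ∧ ∀ (μ : ℝ → P2 d) (a : ℝ → Euc d → Euc d)
      (hμ : Continuous fun s => (μ s).1), IsAdmissible b t T ν μ a →
      MemLp (fun z : ℝ × Euc d => a z.1 z.2) 2 (spaceTime t T μ hμ) →
      ∫ z, ‖a z.1 z.2‖ ^ 2 ∂spaceTime t T μ hμ ≤ c →
      ∀ r ∈ Icc t T, (μ r).1 ∈ secondMomentLE d M := by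
  obtain ⟨B, hB0, hB⟩ := hb.exists_bound
  obtain ⟨L, hL, hφ⟩ := exists_contDiff_truncatedSq_scaled d
  refine ⟨ENNReal.ofReal (2 * (4 * ∫ x, ‖x‖ ^ 2 ∂ν.meas
      + ((L / 2 + L * (T - t) * B ^ 2) * (T - t) + L * (T - t) * c))), ENNReal.ofReal_ne_top,
    fun μ a hμ h ha hc r hr => ?_⟩
  rw [mem_secondMomentLE_iff]
  intro n
  obtain ⟨φ, hφs, hφc, h1, h2, h3, h4⟩ := hφ (n + 1) (by positivity)
  have hpos : ∀ x, 0 ≤ φ x + 4 * ((n : ℝ) + 1) ^ 2 := fun x =>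
    le_trans (le_min (by positivity) (by positivity)) (h1 x)
  have hφi : ∀ m : P2 d, Integrable (fun x => φ x + 4 * ((n : ℝ) + 1) ^ 2) m.meas := fun m =>
    (hφs.continuous.integrable_of_hasCompactSupport hφc).add (integrable_const _)
  have hmain := h.integral_add_const_le hb hB0 hB htT ha hφs hφc hL hpos h3 h4 hc hr
  have hν : ∫ x, (φ x + 4 * ((n : ℝ) + 1) ^ 2) ∂ν.meas ≤ 4 * ∫ x, ‖x‖ ^ 2 ∂ν.meas := by
    rw [← integral_const_mul]
    exact integral_mono (hφi ν) (ν.integrable_norm_sq.const_mul 4) h2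
  calc ∫⁻ x, min (‖x‖ₑ ^ 2) (n : ℝ≥0∞) ∂(μ r).meas
      ≤ ∫⁻ x, ENNReal.ofReal (φ x + 4 * ((n : ℝ) + 1) ^ 2) ∂(μ r).meas := by
        refine lintegral_mono fun x => ?_
        rw [← ofReal_norm, ← ENNReal.ofReal_pow (norm_nonneg _), ← ENNReal.ofReal_natCast,
          ← ENNReal.ofReal_min]
        refine ENNReal.ofReal_le_ofReal ((min_le_min_left _ ?_).trans (h1 x))
        nlinarith [Nat.cast_nonneg (α := ℝ) n]
    _ = ENNReal.ofReal (∫ x, (φ x + 4 * ((n : ℝ) + 1) ^ 2) ∂(μ r).meas) :=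
        (ofReal_integral_eq_lintegral_ofReal (hφi _) (ae_of_all _ hpos)).symm
    _ ≤ _ := by
        refine ENNReal.ofReal_le_ofReal (hmain.trans ?_)
        linarith

end Moments

/-! ### Compactness of paths of measures -/

/-- A sequence of paths in a compact set of probability measures which is equicontinuous when tested
on smooth compactly supported functions has a subsequence converging at every time, with a weakly
continuous limit. -/
theorem exists_subseq_tendsto_path {d : ℕ} {K : Set (ProbabilityMeasure (Euc d))} (hK : IsCompact K)
    {u : ℕ → ℝ → ProbabilityMeasure (Euc d)} (hu : ∀ n s, u n s ∈ K)
    (heq : ∀ φ : Euc d → ℝ, ContDiff ℝ ∞ φ → HasCompactSupport φ → ∀ ε > 0, ∃ δ > 0,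
      ∀ n s r, |s - r| < δ →
        |∫ x, φ x ∂(u n s : Measure (Euc d)) - ∫ x, φ x ∂(u n r : Measure (Euc d))| ≤ ε) :
    ∃ σ : ℕ → ℕ, StrictMono σ ∧ ∃ v : ℝ → ProbabilityMeasure (Euc d),
      (∀ s, v s ∈ K) ∧ (∀ s, Tendsto (fun n => u (σ n) s) atTop (𝓝 (v s))) ∧ Continuous v := by
  have hpi : IsCompact (univ.pi fun _ : ℚ => K) := isCompact_univ_pi fun _ => hK
  obtain ⟨w, -, σ, hσ, hw⟩ := hpi.tendsto_subseq (x := fun n (q : ℚ) => u n (q : ℝ))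
    fun n q _ => hu n q
  rw [tendsto_pi_nhds] at hw
  have hcauchy : ∀ s, ∀ φ : Euc d → ℝ, ContDiff ℝ ∞ φ → HasCompactSupport φ →
      CauchySeq fun n => ∫ x, φ x ∂(u (σ n) s : Measure (Euc d)) := by
    intro s φ hφ hφc
    rw [Metric.cauchySeq_iff']
    intro ε hε
    obtain ⟨δ, hδ, h1⟩ := heq φ hφ hφc (ε / 4) (by positivity)
    obtain ⟨q, hq1, hq2⟩ := exists_rat_btwn (show s < s + δ by linarith)
    have hsq : |s - q| < δ := by rw [abs_sub_comm, abs_of_pos (by linarith)]; linarith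
    have h2 : CauchySeq fun n => ∫ x, φ x ∂(u (σ n) q : Measure (Euc d)) :=
      (((continuous_integral_of_hasCompactSupport hφ.continuous hφc).tendsto (w q)).comp
        (hw q)).cauchySeq
    obtain ⟨N, hN⟩ := Metric.cauchySeq_iff'.1 h2 (ε / 4) (by positivity)
    refine ⟨N, fun n hn => ?_⟩
    have h3 := hN n hn
    have h4 := h1 (σ n) s q hsq
    have h5 := h1 (σ N) s q hsq
    rw [Real.dist_eq] at h3 ⊢
    rw [abs_le] at h4 h5
    rw [abs_lt] at h3 ⊢
    constructor <;> linarith [h3.1, h3.2, h4.1, h4.2, h5.1, h5.2]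
  choose v hvK hv using fun s =>
    exists_tendsto_of_forall_cauchySeq hK (fun n => hu (σ n) s) (hcauchy s)
  refine ⟨σ, hσ, v, hvK, hv, continuous_iff_continuousAt.2 fun s => ?_⟩
  refine tendsto_of_forall_integral_contDiff hK hvK fun φ hφ hφc => ?_
  have hint : ∀ s, Tendsto (fun n => ∫ x, φ x ∂(u (σ n) s : Measure (Euc d))) atTop
      (𝓝 (∫ x, φ x ∂(v s : Measure (Euc d)))) := fun s =>
    ((continuous_integral_of_hasCompactSupport hφ.continuous hφc).tendsto (v s)).comp (hv s)
  rw [Metric.tendsto_nhds_nhds]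
  intro ε hε
  obtain ⟨δ, hδ, h1⟩ := heq φ hφ hφc (ε / 2) (by positivity)
  refine ⟨δ, hδ, fun r hr => ?_⟩
  rw [Real.dist_eq] at hr ⊢
  have := le_of_tendsto ((hint r).sub (hint s)).abs
    (Eventually.of_forall fun n => h1 (σ n) r s hr)
  linarith

/-! ### Recovering the control from the weak formulation -/

/-- A linear functional `J` which is bounded in terms of `‖A w‖` is of the form `w ↦ ⟪a, A w⟫`. -/
theorem exists_inner_eq_of_abs_le {H W : Type*} [NormedAddCommGroup H] [InnerProductSpace ℝ H]
    [CompleteSpace H] [AddCommGroup W] [Module ℝ W] (A : W →ₗ[ℝ] H) (J : W →ₗ[ℝ] ℝ) {C : ℝ}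
    (hC : 0 ≤ C) (h : ∀ w, |J w| ≤ C * ‖A w‖) : ∃ a : H, ‖a‖ ≤ C ∧ ∀ w, J w = inner ℝ a (A w) := by
  have hker : LinearMap.ker A ≤ LinearMap.ker J := fun w hw => by
    have := h w
    rw [LinearMap.mem_ker.1 hw, norm_zero, mul_zero] at this
    exact abs_nonpos_iff.1 this
  let g : LinearMap.range A →ₗ[ℝ] ℝ :=
    ((LinearMap.ker A).liftQ J hker).comp (A.quotKerEquivRange.symm : _ →ₗ[ℝ] _)
  have hg : ∀ w, g ⟨A w, LinearMap.mem_range_self A w⟩ = J w := fun w => by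
    change (LinearMap.ker A).liftQ J hker (A.quotKerEquivRange.symm ⟨A w, _⟩) = J w
    rw [A.quotKerEquivRange_symm_apply_image w (LinearMap.mem_range_self A w)]
    rfl
  have hgC : ∀ y : LinearMap.range A, ‖g y‖ ≤ C * ‖y‖ := by
    rintro ⟨_, w, rfl⟩
    rw [hg w]
    exact h w
  obtain ⟨G, hG, hGn⟩ := exists_extension_norm_eq (𝕜 := ℝ) (LinearMap.range A)
    (g.mkContinuous C hgC)
  refine ⟨(InnerProductSpace.toDual ℝ H).symm G, ?_, fun w => ?_⟩
  · rw [LinearIsometryEquiv.norm_map, hGn]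
    exact LinearMap.mkContinuous_norm_le g hC hgC
  · rw [InnerProductSpace.toDual_symm_apply, hG ⟨A w, LinearMap.mem_range_self A w⟩]
    exact (hg w).symm

section L2

variable {X E : Type*} [MeasurableSpace X] [NormedAddCommGroup E] [InnerProductSpace ℝ E]
  {m : Measure X} {f g : X → E}

theorem integral_inner_eq_inner_toLp (hf : MemLp f 2 m) (hg : MemLp g 2 m) :
    ∫ x, inner ℝ (f x) (g x) ∂m = inner ℝ (hf.toLp f) (hg.toLp g) := by
  rw [L2.inner_def]
  refine integral_congr_ae ?_
  filter_upwards [hf.coeFn_toLp, hg.coeFn_toLp] with x h1 h2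
  rw [h1, h2]

theorem norm_toLp_eq_sqrt (hf : MemLp f 2 m) : ‖hf.toLp f‖ = √(∫ x, ‖f x‖ ^ 2 ∂m) := by
  rw [norm_eq_sqrt_real_inner, ← integral_inner_eq_inner_toLp]
  simp only [real_inner_self_eq_norm_sq]

theorem abs_integral_inner_le (hf : MemLp f 2 m) (hg : MemLp g 2 m) :
    |∫ x, inner ℝ (f x) (g x) ∂m| ≤ √(∫ x, ‖f x‖ ^ 2 ∂m) * √(∫ x, ‖g x‖ ^ 2 ∂m) := by
  rw [integral_inner_eq_inner_toLp hf hg, ← norm_toLp_eq_sqrt hf, ← norm_toLp_eq_sqrt hg]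
  exact abs_real_inner_le_norm _ _

end L2

/-- The vector space of test functions. -/
def testFunctions (d : ℕ) (t T : ℝ) : Submodule ℝ (ℝ × Euc d → ℝ) where
  carrier := {φ | IsTestFunction t T φ}
  add_mem' {φ ψ} hφ hψ := ⟨hφ.1.add hψ.1, hφ.2.1.add hψ.2.1,
    (tsupport_add φ ψ).trans (union_subset hφ.2.2 hψ.2.2)⟩
  zero_mem' := ⟨contDiff_const, HasCompactSupport.zero, by simp [tsupport]⟩
  smul_mem' c φ hφ := ⟨contDiff_const.smul hφ.1, hφ.2.1.smul_left (f := fun _ => c),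
    (closure_mono (Function.support_const_smul_subset c φ)).trans hφ.2.2⟩

section Control

variable {d : ℕ} {b : Euc d → P2 d → Euc d} {t T : ℝ} {μ : ℝ → P2 d}

theorem uncontrolledPart_add {φ ψ : ℝ × Euc d → ℝ} (hφ : ContDiff ℝ ∞ φ) (hψ : ContDiff ℝ ∞ ψ)
    (z : ℝ × Euc d) : uncontrolledPart b μ (φ + ψ) z
      = uncontrolledPart b μ φ z + uncontrolledPart b μ ψ z := by
  simp only [uncontrolledPart, timeDeriv_add hφ hψ, spaceLap_add hφ hψ, spaceGrad_add hφ hψ,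
    inner_add_right]
  ring

theorem uncontrolledPart_smul {φ : ℝ × Euc d → ℝ} (c : ℝ) (hφ : ContDiff ℝ ∞ φ)
    (z : ℝ × Euc d) : uncontrolledPart b μ (c • φ) z = c * uncontrolledPart b μ φ z := by
  simp only [uncontrolledPart, timeDeriv_smul c hφ, spaceLap_smul c hφ, spaceGrad_smul c hφ,
    inner_smul_right]
  ring

/-- If the residual of a path in the uncontrolled Fokker–Planck equation is bounded in terms of the
`L²` norm of the gradient of the test function, then some control of bounded cost makes the path
admissible. (For `c = ∞` the real constant in the hypothesis is zero.) -/
theorem exists_isAdmissible_of_abs_integral_le (hb : DriftAssumption b)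
    (hμ : Continuous fun s => (μ s).1) {c : ℝ≥0∞}
    (h : ∀ φ : ℝ × Euc d → ℝ, IsTestFunction t T φ →
      |∫ z, uncontrolledPart b μ φ z ∂spaceTime t T μ hμ|
        ≤ √(2 * c).toReal * √(∫ z, ‖spaceGrad φ z‖ ^ 2 ∂spaceTime t T μ hμ)) :
    ∃ a : ℝ → Euc d → Euc d, IsAdmissible b t T (μ t) μ a ∧ controlCost t T μ a ≤ c := by
  set Θ := spaceTime t T μ hμ
  have hg : ∀ φ : testFunctions d t T, MemLp (spaceGrad φ.1) 2 Θ := fun φ =>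
    memLp_spaceGrad φ.2.1 φ.2.2.1 Θ
  let A : testFunctions d t T →ₗ[ℝ] Lp (Euc d) 2 Θ :=
    { toFun := fun φ => (hg φ).toLp _
      map_add' := fun φ ψ => by
        rw [← MemLp.toLp_add]
        exact MemLp.toLp_congr _ _ (ae_of_all _ (spaceGrad_add φ.2.1 ψ.2.1))
      map_smul' := fun r φ => by
        rw [RingHom.id_apply, ← MemLp.toLp_const_smul]
        exact MemLp.toLp_congr _ _ (ae_of_all _ (spaceGrad_smul r φ.2.1)) }
  let J : testFunctions d t T →ₗ[ℝ] ℝ :=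
    { toFun := fun φ => -∫ z, uncontrolledPart b μ φ.1 z ∂Θ
      map_add' := fun φ ψ => by
        rw [← neg_add, ← integral_add (integrable_uncontrolledPart hb hμ φ.2.1 φ.2.2.1 Θ)
          (integrable_uncontrolledPart hb hμ ψ.2.1 ψ.2.2.1 Θ)]
        simp only [Submodule.coe_add, uncontrolledPart_add φ.2.1 ψ.2.1]
      map_smul' := fun r φ => by
        simp only [Submodule.coe_smul, uncontrolledPart_smul r φ.2.1, RingHom.id_apply, smul_eq_mul,
          integral_const_mul, mul_neg] }
  obtain ⟨α, hαn, hα⟩ := exists_inner_eq_of_abs_le A J (C := √(2 * c).toReal) (Real.sqrt_nonneg _)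
    fun φ => by
      change |-∫ z, uncontrolledPart b μ φ.1 z ∂Θ| ≤ _ * ‖(hg φ).toLp _‖
      rw [abs_neg, norm_toLp_eq_sqrt]
      exact h φ.1 φ.2
  have hαm : Measurable (α : ℝ × Euc d → Euc d) := (Lp.stronglyMeasurable α).measurable
  have hα2 : MemLp (α : ℝ × Euc d → Euc d) 2 Θ := Lp.memLp α
  refine ⟨fun s x => α (s, x), ⟨hμ.continuousOn, rfl, hαm, fun r => ?_, fun φ hφ => ?_⟩, ?_⟩
  · have h1 : ∫⁻ z, ‖α z‖ₑ ∂Θ < ⊤ := (hα2.integrable (by norm_num)).hasFiniteIntegral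
    rw [lintegral_spaceTime (f := fun z => ‖α z‖ₑ) hαm.enorm] at h1
    exact lt_of_le_of_lt (lintegral_mono fun s => setLIntegral_le_lintegral _ _) h1
  · rw [weakFormulation_eq (hμ := hμ) hb hα2 hφ.1 hφ.2.1]
    have h1 : -∫ z, uncontrolledPart b μ φ z ∂Θ = inner ℝ α ((hg ⟨φ, hφ⟩).toLp _) := hα ⟨φ, hφ⟩
    have h2 := integral_inner_eq_inner_toLp hα2 (hg ⟨φ, hφ⟩)
    rw [Lp.toLp_coeFn] at h2
    rw [← h2] at h1
    linarith
  · rw [controlCost_eq (hμ := hμ) hαm]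
    have h1 : ∫ z, ‖α z‖ ^ 2 ∂Θ ≤ (2 * c).toReal := by
      have h2 := norm_toLp_eq_sqrt hα2
      rw [Lp.toLp_coeFn] at h2
      rw [h2] at hαn
      exact (Real.sqrt_le_sqrt_iff ENNReal.toReal_nonneg).1 hαn
    have h3 : ∫⁻ z, ‖α z‖ₑ ^ 2 ∂Θ ≤ 2 * c := by
      have h4 := ofReal_integral_eq_lintegral_ofReal (hα2.integrable_norm_pow (by norm_num))
        (ae_of_all _ fun z => by positivity)
      have h5 : ∀ z, ENNReal.ofReal (‖α z‖ ^ 2) = ‖α z‖ₑ ^ 2 := fun z => by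
        rw [ENNReal.ofReal_pow (norm_nonneg _), ofReal_norm]
      simp only [h5] at h4
      rw [← h4]
      exact ENNReal.ofReal_le_of_le_toReal h1
    calc 1 / 2 * ∫⁻ z, ‖α z‖ₑ ^ 2 ∂Θ ≤ 1 / 2 * (2 * c) := by gcongr
      _ = c := by
          rw [← mul_assoc, one_div, ENNReal.inv_mul_cancel two_ne_zero ENNReal.ofNat_ne_top,
            one_mul]

end Control

/-! ### Passing to the limit in the weak formulation -/

theorem HasCompactSupport.slice {d : ℕ} {E : Type*} [Zero E] {F : ℝ × Euc d → E}
    (hF : HasCompactSupport F) (s : ℝ) : HasCompactSupport fun x => F (s, x) :=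
  HasCompactSupport.of_support_subset_isCompact (hF.image continuous_snd) fun x hx =>
    ⟨(s, x), subset_tsupport F hx, rfl⟩

section Limit

variable {d : ℕ} {b : Euc d → P2 d → Euc d} {t T : ℝ} {μ : ℕ → ℝ → P2 d} {μ₀ : ℝ → P2 d}
  {hμ : ∀ n, Continuous fun s => (μ n s).1} {hμ₀ : Continuous fun s => (μ₀ s).1}

/-- Space-time integrals converge if the space integrals converge at every time. -/
theorem tendsto_integral_spaceTime {F : ℕ → ℝ × Euc d → ℝ} {F₀ : ℝ × Euc d → ℝ}
    (hF : ∀ n, Integrable (F n) (spaceTime t T (μ n) (hμ n)))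
    (hF₀ : Integrable F₀ (spaceTime t T μ₀ hμ₀)) {C : ℝ} (hC : ∀ n z, ‖F n z‖ ≤ C)
    (h : ∀ s, Tendsto (fun n => ∫ x, F n (s, x) ∂(μ n s).meas) atTop
      (𝓝 (∫ x, F₀ (s, x) ∂(μ₀ s).meas))) :
    Tendsto (fun n => ∫ z, F n z ∂spaceTime t T (μ n) (hμ n)) atTop
      (𝓝 (∫ z, F₀ z ∂spaceTime t T μ₀ hμ₀)) := by
  rw [integral_spaceTime hF₀]
  simp only [fun n => integral_spaceTime (hF n)]
  refine tendsto_integral_of_dominated_convergence (fun _ => C)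
    (fun n => (Integrable.integral_compProd
      (κ := ProbabilityTheory.Kernel.const Unit (volume.restrict (Icc t T)))
      (η := ProbabilityTheory.Kernel.prodMkLeft Unit (pathKernel (μ n) (hμ n))) (a := ()) (hF n)).1)
    (integrable_const C) (fun n => ae_of_all _ fun s => ?_) (ae_of_all _ h)
  refine (norm_integral_le_of_norm_le_const (ae_of_all _ fun x => hC n (s, x))).trans ?_
  simp

theorem tendsto_integral_uncontrolledPart (hb : DriftAssumption b)
    (h : ∀ s, Tendsto (fun n => (μ n s).1) atTop (𝓝 (μ₀ s).1)) {φ : ℝ × Euc d → ℝ}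
    (hφ : ContDiff ℝ ∞ φ) (hc : HasCompactSupport φ) :
    Tendsto (fun n => ∫ z, uncontrolledPart b (μ n) φ z ∂spaceTime t T (μ n) (hμ n)) atTop
      (𝓝 (∫ z, uncontrolledPart b μ₀ φ z ∂spaceTime t T μ₀ hμ₀)) := by
  obtain ⟨B, hB0, hB⟩ := hb.exists_bound
  have hd := hasCompactSupport_timeDeriv hφ hc
  have hl := hasCompactSupport_spaceLap hφ hc
  have hg := hasCompactSupport_spaceGrad hφ hc
  obtain ⟨C₁, hC₁⟩ := hd.exists_bound_of_continuous (continuous_timeDeriv hφ)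
  obtain ⟨C₂, hC₂⟩ := hl.exists_bound_of_continuous (continuous_spaceLap hφ)
  obtain ⟨C₃, hC₃⟩ := hg.exists_bound_of_continuous (continuous_spaceGrad hφ)
  refine tendsto_integral_spaceTime (C := C₁ + 1 / 2 * C₂ + B * C₃)
    (fun n => integrable_uncontrolledPart hb (hμ n) hφ hc _)
    (integrable_uncontrolledPart hb hμ₀ hφ hc _) (fun n z => ?_) fun s => ?_
  · refine (norm_add₃_le).trans ?_
    gcongr
    · exact hC₁ z
    · rw [norm_mul, Real.norm_of_nonneg (by norm_num : (0 : ℝ) ≤ 1 / 2)]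
      gcongr
      exact hC₂ z
    · exact (norm_inner_le_norm _ _).trans
        (mul_le_mul (hB _ _) (hC₃ z) (norm_nonneg _) hB0)
  · have hG : Continuous fun x : Euc d => timeDeriv φ (s, x) + 1 / 2 * spaceLap φ (s, x) := by
      have := continuous_timeDeriv hφ
      have := continuous_spaceLap hφ
      fun_prop
    have hGc : HasCompactSupport fun x : Euc d => timeDeriv φ (s, x) + 1 / 2 * spaceLap φ (s, x) :=
      (hd.slice s).add ((hl.slice s).mul_left (f := fun _ => 1 / 2))
    have hg1 : Continuous fun x : Euc d => spaceGrad φ (s, x) :=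
      (continuous_spaceGrad hφ).comp (by fun_prop)
    have hbc : ∀ m : P2 d, Continuous fun x => b x m := fun m =>
      continuous_iff_continuousAt.2 fun x => hb.tendsto tendsto_const_nhds tendsto_id
    have hsplit : ∀ (ρ : ℝ → P2 d), ∫ x, uncontrolledPart b ρ φ (s, x) ∂(ρ s).meas
        = ∫ x, (timeDeriv φ (s, x) + 1 / 2 * spaceLap φ (s, x)) ∂(ρ s).meas
          + ∫ x, inner ℝ (b x (ρ s)) (spaceGrad φ (s, x)) ∂(ρ s).meas := fun ρ =>
      integral_add (hG.integrable_of_hasCompactSupport hGc)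
        (((hbc (ρ s)).inner hg1).integrable_of_hasCompactSupport
          ((hg.slice s).mono fun x hx h => hx (by simp [h])))
    simp only [hsplit]
    exact (((continuous_integral_of_hasCompactSupport hG hGc).tendsto _).comp (h s)).add
      (hb.tendsto_integral_inner (h s) hg1 (hg.slice s))

theorem tendsto_integral_norm_spaceGrad_sq
    (h : ∀ s, Tendsto (fun n => (μ n s).1) atTop (𝓝 (μ₀ s).1)) {φ : ℝ × Euc d → ℝ}
    (hφ : ContDiff ℝ ∞ φ) (hc : HasCompactSupport φ) :
    Tendsto (fun n => ∫ z, ‖spaceGrad φ z‖ ^ 2 ∂spaceTime t T (μ n) (hμ n)) atTop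
      (𝓝 (∫ z, ‖spaceGrad φ z‖ ^ 2 ∂spaceTime t T μ₀ hμ₀)) := by
  have hcont : Continuous fun z => ‖spaceGrad φ z‖ ^ 2 := (continuous_spaceGrad hφ).norm.pow 2
  have hsupp : HasCompactSupport fun z => ‖spaceGrad φ z‖ ^ 2 :=
    (hasCompactSupport_spaceGrad hφ hc).mono fun z hz h => hz (by simp [h])
  obtain ⟨C, hC⟩ := hsupp.exists_bound_of_continuous hcont
  exact tendsto_integral_spaceTime (fun n => hcont.integrable_of_hasCompactSupport hsupp)
    (hcont.integrable_of_hasCompactSupport hsupp) (fun _ => hC) fun s =>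
    ((continuous_integral_of_hasCompactSupport (φ := fun x => ‖spaceGrad φ (s, x)‖ ^ 2)
      (hcont.comp (by fun_prop)) (hsupp.slice s)).tendsto _).comp (h s)

end Limit

/-! ### Compactness of admissible pairs of bounded cost -/

section Compactness

variable {d : ℕ} {b : Euc d → P2 d → Euc d} {t T : ℝ} {ν : P2 d}

theorem integral_norm_sq_le_of_controlCost_le {μ : ℝ → P2 d} {a : ℝ → Euc d → Euc d}
    {hμ : Continuous fun s => (μ s).1} (ha : Measurable fun p : ℝ × Euc d => a p.1 p.2) {c : ℝ≥0∞}
    (hc : c ≠ ⊤) (h : controlCost t T μ a ≤ c) :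
    ∫ z, ‖a z.1 z.2‖ ^ 2 ∂spaceTime t T μ hμ ≤ (2 * c).toReal := by
  rw [controlCost_eq (hμ := hμ) ha] at h
  have h1 : ∫⁻ z, ‖a z.1 z.2‖ₑ ^ 2 ∂spaceTime t T μ hμ ≤ 2 * c := by
    calc ∫⁻ z, ‖a z.1 z.2‖ₑ ^ 2 ∂spaceTime t T μ hμ
        = 2 * (1 / 2 * ∫⁻ z, ‖a z.1 z.2‖ₑ ^ 2 ∂spaceTime t T μ hμ) := by
          rw [← mul_assoc, one_div, ENNReal.mul_inv_cancel two_ne_zero ENNReal.ofNat_ne_top,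
            one_mul]
      _ ≤ 2 * c := by gcongr
  rw [integral_eq_lintegral_of_nonneg_ae (ae_of_all _ fun z => by positivity)
    (ha.norm.pow_const 2).aestronglyMeasurable]
  refine ENNReal.toReal_mono (ENNReal.mul_ne_top ENNReal.ofNat_ne_top hc) (le_trans ?_ h1)
  refine lintegral_mono fun z => ?_
  rw [ENNReal.ofReal_pow (norm_nonneg _), ofReal_norm]

/-- Admissible paths with controls of bounded cost, extended by their values at the end points, are
equicontinuous when tested on a smooth compactly supported function. -/
theorem exists_equicontinuous (hb : DriftAssumption b) (htT : t ≤ T) {ψ : Euc d → ℝ}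
    (hψ : ContDiff ℝ ∞ ψ) (hψc : HasCompactSupport ψ) {c : ℝ} (hc : 0 ≤ c) {ε : ℝ} (hε : 0 < ε) :
    ∃ δ > 0, ∀ (μ : ℝ → P2 d) (a : ℝ → Euc d → Euc d) (hμ : Continuous fun s => (μ s).1),
      IsAdmissible b t T ν μ a →
      MemLp (fun z : ℝ × Euc d => a z.1 z.2) 2 (spaceTime t T μ hμ) →
      ∫ z, ‖a z.1 z.2‖ ^ 2 ∂spaceTime t T μ hμ ≤ c → ∀ s r : ℝ, |s - r| < δ →
      |∫ x, ψ x ∂(μ (projIcc t T htT s)).meas - ∫ x, ψ x ∂(μ (projIcc t T htT r)).meas| ≤ ε := by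
  obtain ⟨B, hB0, hB⟩ := hb.exists_bound
  obtain ⟨C₁, hC₁⟩ := (hasCompactSupport_laplacian hψ hψc).exists_bound_of_continuous
    (continuous_laplacian hψ)
  obtain ⟨C₂, hC₂⟩ := (hasCompactSupport_gradient hψc).exists_bound_of_continuous
    (continuous_gradient hψ)
  -- `lam` makes the control term at most `ε / 2`, then `δ` makes the term linear in time small.
  obtain ⟨C, hC1, hC2⟩ : ∃ C, C₁ ≤ C ∧ C₂ ≤ C := ⟨_, le_max_left _ _, le_max_right _ _⟩
  have hC0 : 0 ≤ C := (norm_nonneg _).trans ((hC₁ 0).trans hC1)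
  set lam := ε / (C * c + 1) with hlam
  have hlam0 : 0 < lam := by positivity
  set A := C * (1 / 2 + B + 1 / (2 * lam)) with hA
  have hA0 : 0 ≤ A := by positivity
  refine ⟨ε / (2 * (A + 1)), by positivity, fun μ a hμ h ha hac s r hsr => ?_⟩
  have h1 := h.abs_integral_sub_le_mul hb hB0 hB ha hψ hψc
    (fun x => (hC₁ x).trans hC1) (fun x => (hC₂ x).trans hC2) hac hlam0
    (projIcc t T htT s).2 (projIcc t T htT r).2
  rw [← hA] at h1
  have h2 : |(projIcc t T htT s : ℝ) - projIcc t T htT r| ≤ |s - r| := abs_projIcc_sub_projIcc htT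
  have h3 : A * |(projIcc t T htT s : ℝ) - projIcc t T htT r| ≤ ε / 2 := by
    calc A * |(projIcc t T htT s : ℝ) - projIcc t T htT r|
        ≤ (A + 1) * (ε / (2 * (A + 1))) := by
          gcongr
          · linarith
          · exact h2.trans hsr.le
      _ = ε / 2 := by field_simp
  have h4 : C * (lam / 2) * c ≤ ε / 2 := by
    have : C * (lam / 2) * c = ε / 2 * (C * c / (C * c + 1)) := by rw [hlam]; ring
    rw [this]
    exact mul_le_of_le_one_right (by positivity)
      ((div_le_one (by positivity)).2 (by linarith))
  linarith

/-- A sequence of admissible pairs of bounded cost has a subsequence whose terminal measures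
converge to the terminal measure of an admissible pair satisfying the same bound. -/
theorem exists_isAdmissible_of_seq (hb : DriftAssumption b) (htT : t < T) {c : ℝ≥0∞} (hc : c ≠ ⊤)
    {μ : ℕ → ℝ → P2 d} {a : ℕ → ℝ → Euc d → Euc d} (h : ∀ n, IsAdmissible b t T ν (μ n) (a n))
    (hcost : ∀ n, controlCost t T (μ n) (a n) ≤ c) :
    ∃ σ : ℕ → ℕ, StrictMono σ ∧ ∃ (μ₀ : ℝ → P2 d) (a₀ : ℝ → Euc d → Euc d),
      IsAdmissible b t T ν μ₀ a₀ ∧ controlCost t T μ₀ a₀ ≤ c ∧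
      Tendsto (fun n => (μ (σ n) T).1) atTop (𝓝 (μ₀ T).1) := by
  -- Replace the paths by their continuous extensions from `[t, T]` to `ℝ`.
  set w : ℕ → ℝ → P2 d := fun n s => μ n (projIcc t T htT.le s) with hw
  have hadm : ∀ n, IsAdmissible b t T ν (w n) (a n) := fun n => ((h n).clamp htT.le).1
  have hwcost : ∀ n, controlCost t T (w n) (a n) ≤ c := fun n =>
    (((h n).clamp htT.le).2.1).trans_le (hcost n)
  have hwc : ∀ n, Continuous fun s => (w n s).1 := fun n => ((h n).clamp htT.le).2.2
  have hwproj : ∀ n s, w n (projIcc t T htT.le s) = w n s := fun n s => by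
    simp only [hw, projIcc_val]
  have hL : ∀ n, MemLp (fun z : ℝ × Euc d => a n z.1 z.2) 2 (spaceTime t T (w n) (hwc n)) :=
    fun n => memLp_of_controlCost_lt_top (h n).measurable ((hwcost n).trans_lt hc.lt_top)
  have hnorm : ∀ n, ∫ z, ‖a n z.1 z.2‖ ^ 2 ∂spaceTime t T (w n) (hwc n) ≤ (2 * c).toReal :=
    fun n => integral_norm_sq_le_of_controlCost_le (h n).measurable hc (hwcost n)
  obtain ⟨M, hM, hmom⟩ := exists_secondMoment_bound hb htT ν (2 * c).toReal
  have hK : ∀ n s, (w n s).1 ∈ secondMomentLE d M := fun n s => by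
    rw [← hwproj n s]
    exact hmom (w n) (a n) (hwc n) (hadm n) (hL n) (hnorm n) _ (projIcc t T htT.le s).2
  obtain ⟨σ, hσ, v, hvK, hv, hvc⟩ := exists_subseq_tendsto_path (isCompact_secondMomentLE d hM) hK
    fun φ hφ hφc ε hε => by
      obtain ⟨δ, hδ, hδ'⟩ := exists_equicontinuous (ν := ν) hb htT.le hφ hφc
        (ENNReal.toReal_nonneg (a := 2 * c)) hε
      refine ⟨δ, hδ, fun n s r hsr => ?_⟩
      have := hδ' (w n) (a n) (hwc n) (hadm n) (hL n) (hnorm n) s r hsr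
      rwa [hwproj, hwproj] at this
  let μ₀ : ℝ → P2 d := fun s => ⟨v s, (hvK s).trans_lt hM.lt_top⟩
  have hν : μ₀ t = ν := Subtype.ext (tendsto_nhds_unique (hv t) (by
    simp only [(hadm _).initial]
    exact tendsto_const_nhds))
  have hlim : ∀ s, Tendsto (fun n => (w (σ n) s).1) atTop (𝓝 (μ₀ s).1) := hv
  -- The bound on the controls turns into a bound on the residual of the uncontrolled equation,
  -- which, unlike the controls, passes to the limit.
  obtain ⟨a₀, ha₀, hcost₀⟩ := exists_isAdmissible_of_abs_integral_le (t := t) (T := T) (μ := μ₀)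
    (c := c) hb hvc fun φ hφ => by
      have hres : ∀ n,
          |∫ z, uncontrolledPart b (w (σ n)) φ z ∂spaceTime t T (w (σ n)) (hwc (σ n))|
          ≤ √(2 * c).toReal
            * √(∫ z, ‖spaceGrad φ z‖ ^ 2 ∂spaceTime t T (w (σ n)) (hwc (σ n))) := fun n => by
        have h1 := (hadm (σ n)).equation φ hφ
        rw [weakFormulation_eq hb (hL (σ n)) hφ.1 hφ.2.1] at h1
        rw [eq_neg_of_add_eq_zero_left h1, abs_neg]
        refine (abs_integral_inner_le (hL (σ n)) (memLp_spaceGrad hφ.1 hφ.2.1 _)).trans ?_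
        gcongr
        exact hnorm (σ n)
      exact le_of_tendsto_of_tendsto'
        (tendsto_integral_uncontrolledPart hb hlim hφ.1 hφ.2.1).abs
        ((tendsto_integral_norm_spaceGrad_sq hlim hφ.1 hφ.2.1).sqrt.const_mul _) hres
  rw [hν] at ha₀
  refine ⟨σ, hσ, μ₀, a₀, ha₀, hcost₀, ?_⟩
  have := hlim T
  simpa only [hw, projIcc_right] using this

end Compactness

/-! ### Terminal measures and the Wasserstein distance -/

section Wasserstein

variable {d : ℕ}

theorem wasserstein2_self (m : P2 d) : wasserstein2 m m = 0 := by
  have h : (⨅ (π : Measure (Euc d × Euc d))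
      (_ : π.map Prod.fst = m.meas ∧ π.map Prod.snd = m.meas),
      ∫⁻ z, edist z.1 z.2 ^ 2 ∂π) = 0 := by
    refine le_antisymm (iInf₂_le_of_le (m.meas.map fun x => (x, x)) ⟨?_, ?_⟩ ?_) zero_le
    · rw [Measure.map_map measurable_fst (by fun_prop)]
      exact Measure.map_id
    · rw [Measure.map_map measurable_snd (by fun_prop)]
      exact Measure.map_id
    · rw [lintegral_map (by fun_prop) (by fun_prop)]
      simp
  rw [wasserstein2, h]
  exact ENNReal.zero_rpow_of_pos (by norm_num)

/-- Integrals of Lipschitz functions are Lipschitz for `𝒲₂`: bound `dist` by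
`dist² / (2 ε) + ε / 2` and integrate against a coupling of cost less than `ε²`. -/
theorem abs_integral_sub_le_of_wasserstein2_lt {m m' : P2 d} {ε : ℝ} (hε : 0 < ε)
    (h : wasserstein2 m m' < ENNReal.ofReal ε) {φ : Euc d → ℝ} {K : NNReal}
    (hφ : LipschitzWith K φ) (hφc : HasCompactSupport φ) :
    |∫ x, φ x ∂m.meas - ∫ x, φ x ∂m'.meas| ≤ K * ε := by
  have h1 : (⨅ (π : Measure (Euc d × Euc d))
      (_ : π.map Prod.fst = m.meas ∧ π.map Prod.snd = m'.meas),
      ∫⁻ z, edist z.1 z.2 ^ 2 ∂π) < ENNReal.ofReal ε ^ 2 := by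
    rw [wasserstein2, one_div] at h
    have := (ENNReal.rpow_inv_lt_iff (by norm_num)).1 h
    simpa using this
  simp only [iInf_lt_iff] at h1
  obtain ⟨π, ⟨hπ1, hπ2⟩, hπ⟩ := h1
  have hprob : IsProbabilityMeasure π := ⟨by
    have h2 : m.meas univ = 1 := measure_univ
    rwa [← hπ1, Measure.map_apply measurable_fst MeasurableSet.univ, preimage_univ] at h2⟩
  have hi : ∀ f : Euc d × Euc d → Euc d, Continuous f → Integrable (fun z => φ (f z)) π :=
    fun f hf => by
      obtain ⟨C, hC⟩ := hφc.exists_bound_of_continuous hφ.continuous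
      exact .of_bound (hφ.continuous.comp hf).aestronglyMeasurable C (ae_of_all _ fun z => hC _)
  have hd2 : Integrable (fun z : Euc d × Euc d => dist z.1 z.2 ^ 2) π ∧
      ∫ z, dist z.1 z.2 ^ 2 ∂π ≤ ε ^ 2 := by
    have h3 : ∀ z : Euc d × Euc d, ‖dist z.1 z.2 ^ 2‖ₑ = edist z.1 z.2 ^ 2 := fun z => by
      rw [← ofReal_norm, Real.norm_of_nonneg (by positivity), ENNReal.ofReal_pow dist_nonneg,
        edist_dist]
    refine ⟨⟨by fun_prop, ?_⟩, ?_⟩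
    · simp only [HasFiniteIntegral, h3]
      exact hπ.trans (ENNReal.pow_lt_top ENNReal.ofReal_lt_top)
    · rw [integral_eq_lintegral_of_nonneg_ae (ae_of_all _ fun z => by positivity) (by fun_prop)]
      refine ENNReal.toReal_le_of_le_ofReal (by positivity) ?_
      rw [ENNReal.ofReal_pow hε.le]
      refine le_trans (le_of_eq (lintegral_congr fun z => ?_)) hπ.le
      rw [ENNReal.ofReal_pow dist_nonneg, edist_dist]
  have hpt : ∀ z : Euc d × Euc d,
      ‖φ z.1 - φ z.2‖ ≤ K * (1 / (2 * ε) * dist z.1 z.2 ^ 2 + ε / 2) := fun z => by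
    have h4 := hφ.dist_le_mul z.1 z.2
    rw [Real.dist_eq] at h4
    refine h4.trans (mul_le_mul_of_nonneg_left ?_ K.2)
    have h5 := mul_le_add_sq (x := 1) (y := dist z.1 z.2) hε
    linarith
  rw [← hπ1, ← hπ2, integral_map (by fun_prop) hφ.continuous.aestronglyMeasurable,
    integral_map (by fun_prop) hφ.continuous.aestronglyMeasurable,
    ← integral_sub (hi _ continuous_fst) (hi _ continuous_snd)]
  refine (norm_integral_le_of_norm_le (((hd2.1.const_mul _).add (integrable_const _)).const_mul _)
    (ae_of_all _ hpt)).trans ?_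
  rw [integral_const_mul]
  simp only [Pi.add_apply]
  rw [integral_add (hd2.1.const_mul _) (integrable_const _), integral_const_mul]
  refine mul_le_mul_of_nonneg_left ?_ K.2
  have h6 : 1 / (2 * ε) * ∫ z, dist z.1 z.2 ^ 2 ∂π ≤ 1 / (2 * ε) * ε ^ 2 := by
    gcongr
    exact hd2.2
  have h7 : 1 / (2 * ε) * ε ^ 2 = ε / 2 := by field_simp
  simp only [integral_const, probReal_univ, smul_eq_mul, one_mul]
  linarith

/-- A weak limit of measures whose Wasserstein distance to `m` tends to zero is `m`. -/
theorem eq_of_tendsto_of_wasserstein2_lt {u : ℕ → P2 d} {m m₀ : P2 d}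
    (hu : Tendsto (fun n => (u n).1) atTop (𝓝 m₀.1)) {ε : ℕ → ℝ} (hε : ∀ n, 0 < ε n)
    (hε0 : Tendsto ε atTop (𝓝 0)) (h : ∀ n, wasserstein2 (u n) m < ENNReal.ofReal (ε n)) :
    m₀ = m := by
  refine Subtype.ext (probabilityMeasure_ext_of_integral_contDiff fun φ hφ hφc => ?_)
  obtain ⟨K, hK⟩ := hφ.lipschitzWith_of_hasCompactSupport hφc (by simp)
  have h1 : Tendsto (fun n => ∫ x, φ x ∂(u n).meas) atTop (𝓝 (∫ x, φ x ∂m₀.meas)) :=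
    ((continuous_integral_of_hasCompactSupport hφ.continuous hφc).tendsto _).comp hu
  have h2 : Tendsto (fun n => ∫ x, φ x ∂(u n).meas) atTop (𝓝 (∫ x, φ x ∂m.meas)) := by
    refine tendsto_iff_dist_tendsto_zero.2 (squeeze_zero (fun _ => dist_nonneg)
      (fun n => abs_integral_sub_le_of_wasserstein2_lt (hε n) (h n) hK hφc) ?_)
    simpa using hε0.const_mul (K : ℝ)
  exact tendsto_nhds_unique h1 h2

end Wasserstein

theorem minimalCost_anti {d : ℕ} (b : Euc d → P2 d → Euc d) (t T : ℝ) (ν : P2 d) {S S' : Set (P2 d)}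
    (h : S ⊆ S') : minimalCost b t T ν S' ≤ minimalCost b t T ν S :=
  iInf_mono fun _ => iInf_mono fun _ => iInf_mono fun _ => iInf_mono' fun hS => ⟨h hS, le_rfl⟩

theorem exists_of_minimalCost_lt {d : ℕ} {b : Euc d → P2 d → Euc d} {t T : ℝ} {ν : P2 d}
    {S : Set (P2 d)} {c : ℝ≥0∞} (h : minimalCost b t T ν S < c) :
    ∃ μ a, IsAdmissible b t T ν μ a ∧ μ T ∈ S ∧ controlCost t T μ a < c := by
  simpa only [minimalCost, iInf_lt_iff, exists_prop] using h

theorem minimalCost_le {d : ℕ} {b : Euc d → P2 d → Euc d} {t T : ℝ} {ν : P2 d} {S : Set (P2 d)}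
    {μ : ℝ → P2 d} {a : ℝ → Euc d → Euc d} (h : IsAdmissible b t T ν μ a) (hS : μ T ∈ S) :
    minimalCost b t T ν S ≤ controlCost t T μ a :=
  iInf_le_of_le μ (iInf_le_of_le a (iInf_le_of_le h (iInf_le _ hS)))

end

theorem mainTheorem6 (d : ℕ) (b : Euc d → P2 d → Euc d) (hb : DriftAssumption b)
    (t T : ℝ) (ht : 0 ≤ t) (htT : t < T) (ν μT : P2 d) :
    Tendsto
      (fun ε : ℝ => minimalCost b t T ν {m | wasserstein2 m μT ≤ ENNReal.ofReal ε})
      (𝓝[>] 0) (𝓝 (minimalCost b t T ν {μT})) := by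
  have hle : ∀ ε : ℝ, minimalCost b t T ν {m | wasserstein2 m μT ≤ ENNReal.ofReal ε}
      ≤ minimalCost b t T ν {μT} := fun ε =>
    minimalCost_anti b t T ν (singleton_subset_iff.2 (by
      rw [mem_ofPred_eq, wasserstein2_self]
      exact zero_le))
  refine tendsto_order.2 ⟨fun c hc => ?_, fun c hc => Eventually.of_forall fun ε =>
    (hle ε).trans_lt hc⟩
  suffices hex : ∃ ε > 0, c < minimalCost b t T ν {m | wasserstein2 m μT ≤ ENNReal.ofReal ε} by
    obtain ⟨ε, hε, h⟩ := hex
    filter_upwards [Ioc_mem_nhdsGT hε] with ε' hε'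
    refine h.trans_le (minimalCost_anti b t T ν fun m hm => ?_)
    exact le_trans hm (ENNReal.ofReal_le_ofReal hε'.2)
  -- Otherwise there are admissible pairs of cost at most `c' < V_0` with terminal measures
  -- approaching `μT`, and the limiting pair is a competitor for `V_0`.
  by_contra! hcon
  obtain ⟨c', hcc', hc'⟩ := exists_between hc
  choose μ a hadm hS hcost using fun n : ℕ => exists_of_minimalCost_lt
    ((hcon (1 / ((n : ℝ) + 1)) (by positivity)).trans_lt hcc')
  obtain ⟨σ, hσ, μ₀, a₀, h₀, hcost₀, hlim⟩ := exists_isAdmissible_of_seq hb htT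
    (hc'.trans_le le_top).ne hadm fun n => (hcost n).le
  have hT : μ₀ T = μT := by
    refine eq_of_tendsto_of_wasserstein2_lt hlim (ε := fun n => 2 * (1 / ((σ n : ℝ) + 1)))
      (fun n => by positivity) ?_ fun n => ?_
    · have := (tendsto_one_div_add_atTop_nhds_zero_nat (𝕜 := ℝ)).comp hσ.tendsto_atTop
      simpa using this.const_mul 2
    · refine (hS (σ n)).trans_lt ((ENNReal.ofReal_lt_ofReal_iff (by positivity)).2 ?_)
      have : (0 : ℝ) < 1 / ((σ n : ℝ) + 1) := by positivity
      linarith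
  exact absurd ((minimalCost_le h₀ hT).trans hcost₀) (not_le.2 hc')
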